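/- Conventions. Categories are locally small; "set" means small set, and directed posets are nonempty. A category $\mathsf A$ is *finitely accessible* if it has all directed colimits and there is a set of finitely presentable objects such that every object is a directed colimit of objects from this set ($S$ is finitely presentable if $\operatorname{Hom}_{\mathsf A}(S,-)$ preserves directed colimits). An *exact structure* on an additive category is one in the sense of Quillen; its admissible short exact sequences $0\to X\xrightarrow{i}Y\xrightarrow{p}Z\to 0$ are called conflations, the maps $i$ inflations, and the maps $p$ deflations. Directed colimits of conflations are taken in the category of three-term complexes. An exact structure on $\mathsf A$ has *exact functors of directed colimit* if all directed colimits exist in $\mathsf A$ and directed colimits of conflations are conflations. An exact structure on a finitely accessible additive category is *locally coherent* if the conflations are precisely the directed colimits of conflations with finitely presentable terms. A *chain of inflations* indexed by an ordinal $\lambda>0$ is a functor $(X_\beta)_{\beta<\lambda}$ with $X_\gamma=\varinjlim_{\beta<\gamma}X_\beta$ for all limit ordinals $\gamma<\lambda$ and with $X_\beta\to X_{\beta+1}$ an inflation whenever $\beta+1<\lambda$; its transfinite composition is $X_0\to\varinjlim_{\beta<\lambda}X_\beta$. An object $X$ is *filtered by* a class $\mathsf U$ if there are an ordinal $\alpha$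 and a chain of inflations $(F_\beta)_{\beta\le\alpha}$ with $F_0=0$, $F_\alpha\cong X$, and $\operatorname{coker}(F_\beta\to F_{\beta+1})$ isomorphic to an object of $\mathsf U$ for all $\beta<\alpha$. An exact category $\mathsf A$ is *of Grothendieck type* (in the sense of Šťovíček) if * (GT0) $\mathsf A$ is weakly idempotent complete: every split monomorphism has a cokernel; * (GT1) all transfinite compositions of inflations exist and are inflations; * (GT2) every object $X$ is small relative to inflations: there is a regular cardinal $\kappa$ such that $\operatorname{Hom}_{\mathsf A}(X,-)$ preserves the colimit of every chain of inflations indexed by a limit ordinal of cofinality $\ge\kappa$; * (GT3) there is an object $G$ such that every object $X$ admits a deflation $G^{(I)}\to X$ from a coproduct of copies of $G$ indexed by a set $I$; * (GT4) $\mathsf A$ is deconstructible in itself: there is a set of objects $\mathsf U$ such that every object of $\mathsf A$ is filtered by $\mathsf U$. An object $I$ is *injective* if every morphism $X\to I$ extends along every inflation $X\to Y$; there are *enough injectives* if every object admits an inflation into an injective object. **Theorem.** Let $\mathsf A$ be a finitely accessible additive category endowed with an exact structure. 1. If the exact structure has exact functors of directed colimit, then $\mathsf A$ is an exact category of Grothendieck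 type. 2. If the exact structure is locally coherent, then $\mathsf A$ is an exact category of Grothendieck type and has enough injective objects. -/

import Mathlib

open CategoryTheory CategoryTheory.Limits Opposite

universe v u

/-- An exact structure (in the sense of Quillen) on an additive category `A`: a class of
kernel-cokernel pairs `X ⟶ Y ⟶ Z`, called conflations or admissible short exact sequences,
satisfying the axioms [E0], [E0ᵒᵖ], [E1], [E1ᵒᵖ], [E2], [E2ᵒᵖ]. The morphisms `f` (resp. `g`)
occurring in conflations are the inflations, or admissible monomorphisms (resp. the deflations,
or admissible epimorphisms). -/
structure ExactStructure (A : Type u) [Category.{v} A] [Preadditive A] where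
  /-- the class of admissible short exact sequences -/
  conflations : ObjectProperty (ShortComplex A)
  of_iso : ∀ {S T : ShortComplex A}, (S ≅ T) → conflations S → conflations T
  isKernel : ∀ {S : ShortComplex A}, conflations S →
    Nonempty (IsLimit (KernelFork.ofι S.f S.zero))
  isCokernel : ∀ {S : ShortComplex A}, conflations S →
    Nonempty (IsColimit (CokernelCofork.ofπ S.g S.zero))
  inflation_id : ∀ X : A, ∃ (Z : A) (g : X ⟶ Z) (w : 𝟙 X ≫ g = 0),
    conflations (ShortComplex.mk (𝟙 X) g w)
  deflation_id : ∀ X : A, ∃ (K : A) (f : K ⟶ X) (w : f ≫ 𝟙 X = 0),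
    conflations (ShortComplex.mk f (𝟙 X) w)
  inflation_comp : ∀ {X Y Z : A} (i : X ⟶ Y) (j : Y ⟶ Z),
    (∃ (W : A) (g : Y ⟶ W) (w : i ≫ g = 0), conflations (ShortComplex.mk i g w)) →
    (∃ (W : A) (g : Z ⟶ W) (w : j ≫ g = 0), conflations (ShortComplex.mk j g w)) →
    ∃ (W : A) (g : Z ⟶ W) (w : (i ≫ j) ≫ g = 0), conflations (ShortComplex.mk (i ≫ j) g w)
  deflation_comp : ∀ {X Y Z : A} (p : X ⟶ Y) (q : Y ⟶ Z),
    (∃ (K : A) (f : K ⟶ X) (w : f ≫ p = 0), conflations (ShortComplex.mk f p w)) →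
    (∃ (K : A) (f : K ⟶ Y) (w : f ≫ q = 0), conflations (ShortComplex.mk f q w)) →
    ∃ (K : A) (f : K ⟶ X) (w : f ≫ p ≫ q = 0), conflations (ShortComplex.mk f (p ≫ q) w)
  /-- The push-out of an inflation along any morphism exists and is an inflation. -/
  inflation_pushout : ∀ {X Y X' : A} (i : X ⟶ Y) (f : X ⟶ X'),
    (∃ (W : A) (g : Y ⟶ W) (w : i ≫ g = 0), conflations (ShortComplex.mk i g w)) →
    ∃ (Y' : A) (f' : Y ⟶ Y') (i' : X' ⟶ Y'), IsPushout i f f' i' ∧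
      ∃ (W : A) (g : Y' ⟶ W) (w : i' ≫ g = 0), conflations (ShortComplex.mk i' g w)
  /-- The pull-back of a deflation along any morphism exists and is a deflation. -/
  deflation_pullback : ∀ {Y Z Z' : A} (p : Y ⟶ Z) (f : Z' ⟶ Z),
    (∃ (K : A) (k : K ⟶ Y) (w : k ≫ p = 0), conflations (ShortComplex.mk k p w)) →
    ∃ (Y' : A) (f' : Y' ⟶ Y) (p' : Y' ⟶ Z'), IsPullback f' p' p f ∧
      ∃ (K : A) (k : K ⟶ Y') (w : k ≫ p' = 0), conflations (ShortComplex.mk k p' w)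

namespace ExactStructure

variable {A : Type u} [Category.{v} A] [Preadditive A] (E : ExactStructure A)

/-- The class of inflations (admissible monomorphisms). -/
def inflations : MorphismProperty A := fun _ Y i =>
  ∃ (Z : A) (g : Y ⟶ Z) (w : i ≫ g = 0), E.conflations (ShortComplex.mk i g w)

/-- The class of deflations (admissible epimorphisms). -/
def deflations : MorphismProperty A := fun X _ p =>
  ∃ (K : A) (f : K ⟶ X) (w : f ≫ p = 0), E.conflations (ShortComplex.mk f p w)

/-- The exact category has exact functors of directed colimit: all directed colimits (indexed by
nonempty directed posets) exist in `A`, and a directed colimit, in the category of three-term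
complexes, of admissible short exact sequences is an admissible short exact sequence. -/
structure HasExactDirectedColimits : Prop where
  hasColimits : ∀ (J : Type v) [PartialOrder J] [IsDirectedOrder J] [Nonempty J],
    HasColimitsOfShape J A
  closed : ∀ (J : Type v) [PartialOrder J] [IsDirectedOrder J] [Nonempty J],
    E.conflations.IsClosedUnderColimitsOfShape J

/-- The admissible short exact sequences all of whose terms are finitely presentable. -/
def fpConflations : ObjectProperty (ShortComplex A) := fun S =>
  E.conflations S ∧ IsFinitelyPresentable.{v} S.X₁ ∧ IsFinitelyPresentable.{v} S.X₂ ∧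
    IsFinitelyPresentable.{v} S.X₃

/-- An exact structure (on a finitely accessible additive category) is locally coherent if the
admissible short exact sequences are precisely the directed colimits, in the category of
three-term complexes, of admissible short exact sequences of finitely presentable objects. -/
def IsLocallyCoherent : Prop :=
  ∀ S : ShortComplex A, E.conflations S ↔
    ∃ (J : Type v) (_ : PartialOrder J) (_ : IsDirectedOrder J) (_ : Nonempty J),
      E.fpConflations.colimitsOfShape J S

section Chains

variable {J : Type v} [LinearOrder J] [SuccOrder J] [OrderBot J] [WellFoundedLT J]

/-- A functor from a well-ordered set (i.e. a nonzero ordinal) is a chain of inflations if it is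
smooth (the value at each limit element is the colimit of the previous values) and all the maps
from the value at an element to the value at its successor are inflations. -/
structure IsInflationChain (F : J ⥤ A) : Prop where
  smooth : F.IsWellOrderContinuous
  succ : ∀ j : J, ¬ IsMax j → E.inflations (F.map (homOfLE (Order.le_succ j)))

end Chains

/-- `X` is small relative to the class of all inflations: there is a regular cardinal `κ` such
that `Hom(X, -)` preserves the colimit of every chain of inflations indexed by a limit ordinal of
cofinality at least `κ`. -/
def IsSmallObject (X : A) : Prop :=
  ∃ (κ : Cardinal.{v}) (_ : Fact κ.IsRegular),
    ∀ (J : Type v) [LinearOrder J] [SuccOrder J] [OrderBot J] [WellFoundedLT J] [NoMaxOrder J]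
      [IsCardinalFiltered J κ] (F : J ⥤ A),
      E.IsInflationChain F → PreservesColimit F (coyoneda.obj (op X))

/-- `X` is filtered by objects from the class `U`. The well-ordered set `J` with a greatest
element represents the set of all ordinals `≤ α`. -/
def IsFilteredBy (U : ObjectProperty A) (X : A) : Prop :=
  ∃ (J : Type v) (_ : LinearOrder J) (_ : SuccOrder J) (_ : OrderBot J) (_ : OrderTop J)
    (_ : WellFoundedLT J) (F : J ⥤ A),
    F.IsWellOrderContinuous ∧ IsZero (F.obj ⊥) ∧ Nonempty (F.obj ⊤ ≅ X) ∧
    ∀ j : J, ¬ IsMax j → ∃ (Z : A) (p : F.obj (Order.succ j) ⟶ Z)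
      (w : F.map (homOfLE (Order.le_succ j)) ≫ p = 0),
      U Z ∧ E.conflations (ShortComplex.mk (F.map (homOfLE (Order.le_succ j))) p w)

/-- The exact category is deconstructible in itself: there is a set of objects by which
every object is filtered. -/
def IsDeconstructibleInItself : Prop :=
  ∃ U : ObjectProperty A, ObjectProperty.Small.{v} U ∧ ∀ X : A, E.IsFilteredBy U X

/-- Efficient exact categories. -/
structure IsEfficient : Prop where
  /-- The category is weakly idempotent complete: every section has a cokernel. -/
  weaklyIdempotentComplete : ∀ {X Y : A} (s : X ⟶ Y), IsSplitMono s → HasCokernel s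
  /-- Arbitrary transfinite compositions of inflations exist and are inflations. -/
  transfiniteComposition : ∀ (J : Type v) [LinearOrder J] [SuccOrder J] [OrderBot J]
    [WellFoundedLT J] (F : J ⥤ A), E.IsInflationChain F →
      HasColimit F ∧ ∀ (c : Cocone F), IsColimit c → E.inflations (c.ι.app ⊥)
  /-- Every object is small relative to the class of all inflations. -/
  small : ∀ X : A, E.IsSmallObject X
  /-- There is a generator `G`: every object `X` admits a deflation onto it from a coproduct
  of copies of `G`. -/
  generator : ∃ G : A, ∀ X : A, ∃ (I : Type v) (c : Cofan (fun _ : I => G)) (p : c.pt ⟶ X),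
    Nonempty (IsColimit c) ∧ E.deflations p

/-- Exact categories of Grothendieck type: efficient exact categories that are deconstructible
in themselves. -/
structure IsOfGrothendieckType : Prop extends E.IsEfficient where
  deconstructible : E.IsDeconstructibleInItself

/-- `I` is injective in the exact category: morphisms into `I` extend along inflations. -/
def IsInjective (I : A) : Prop :=
  ∀ {X Y : A} (i : X ⟶ Y) (f : X ⟶ I), E.inflations i → ∃ g : Y ⟶ I, i ≫ g = f

/-- The exact category has enough injective objects. -/
def EnoughInjectives : Prop :=
  ∀ X : A, ∃ (I : A) (i : X ⟶ I), E.IsInjective I ∧ E.inflations i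

end ExactStructure

/-! An object X of a finitely accessible category is determined by its generalized elements, the
maps into X from finitely presentable objects, and a presheaf of such elements is representable as
soon as its category of elements is filtered. Call a sequence pure exact if it is exact on
generalized elements. Pure subobjects, and their quotients, can then be built by hand as presheaves.

The key point is `conflations_of_pureExact`. A pure exact sequence X₁ → X₂ → X₃ is the filtered
colimit, over all finitely presentable s → X₃, of split sequences X₁ → X₁ ⊞ s → s. Split sequences
are conflations in every exact structure, so pure exact sequences are conflations once directed
colimits are exact. Hence split monomorphisms have cokernels, and the map onto X from copies of the
coproduct of all finitely presentable objects is a deflation. Transfinite composition is handled by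
stability of inflations under filtered colimits, and smallness by accessibility. For
deconstructibility, a closure argument bounds the size of the pure subobject generated by one
element (`exists_pureSubobject_family`); adding one such subobject of the current quotient at a time
gives `exists_pureFiltration`.

In the locally coherent case, conflations with finitely presentable terms are finitely presentable
as complexes, so their ind-closure is closed under filtered colimits and the first part applies. For
injectives, let U d be the filtering objects and K d → P d → U d pure exact with P d pure
projective. The small object argument embeds X in an I to which maps extend along every K d → P d
and every inflation between finitely presentable objects. The second family makes every conflation I
→ Y → Z surjective on generalized elements (`exists_lift_of_extends`). The first makes the lifting
problem solvable at each step of the filtration of Z (`hasLiftingProperty`), as in Eklof's lemma. So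
the identity of Z lifts, the conflation splits, and I is injective. -/

/-! ### Generalized elements on finitely presentable objects. -/

section FP

variable (A : Type u) [Category.{v} A] [IsFinitelyAccessibleCategory.{v} A]

/-- A small category equivalent to the category of finitely presentable objects of `A`. -/
def FP : Type v := SmallModel.{v} (ObjectProperty.isFinitelyPresentable.{v} A).FullSubcategory

noncomputable instance : SmallCategory (FP A) :=
  inferInstanceAs (SmallCategory (SmallModel.{v}
    (ObjectProperty.isFinitelyPresentable.{v} A).FullSubcategory))

/-- The equivalence between `FP A` and the full subcategory of finitely presentable objects. -/
noncomputable def fpEquivalence :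
    FP A ≌ (ObjectProperty.isFinitelyPresentable.{v} A).FullSubcategory :=
  (equivSmallModel.{v} (ObjectProperty.isFinitelyPresentable.{v} A).FullSubcategory).symm

/-- The fully faithful functor from the small category of finitely presentable objects. -/
noncomputable def fpι : FP A ⥤ A :=
  (fpEquivalence A).functor ⋙ (ObjectProperty.isFinitelyPresentable.{v} A).ι

instance : (fpι A).Full := by unfold fpι; infer_instance
instance : (fpι A).Faithful := by unfold fpι; infer_instance
instance : (fpι A).IsDense := by unfold fpι; infer_instance

instance (X : A) : IsFiltered (CostructuredArrow (fpι A) X) :=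
  IsFiltered.of_equivalence (CostructuredArrow.pre (fpEquivalence A).functor
    (ObjectProperty.isFinitelyPresentable.{v} A).ι X).asEquivalence.symm

variable {A}

/-- The finitely presentable object of `A` given by an object of the small model. -/
noncomputable abbrev FP.obj (s : FP A) : A := (fpι A).obj s

instance (s : FP A) : IsFinitelyPresentable.{v} s.obj :=
  ((fpEquivalence A).functor.obj s).property

lemma FP.exists_iso (X : A) [hX : IsFinitelyPresentable.{v} X] :
    ∃ s : FP A, Nonempty (s.obj ≅ X) :=
  ⟨(fpEquivalence A).inverse.obj ⟨X, hX⟩,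
    ⟨(ObjectProperty.ι _).mapIso ((fpEquivalence A).counitIso.app ⟨X, hX⟩)⟩⟩

variable (A) in
lemma hasFilteredColimits_of_isFinitelyAccessible : HasFilteredColimitsOfSize.{v, v} A :=
  HasCardinalFilteredColimits_iff_hasFilteredColimitsOfSize.1 inferInstance

attribute [local instance] hasFilteredColimits_of_isFinitelyAccessible

/-- The canonical cocone with point `X` on the diagram of finitely presentable objects over `X`. -/
@[simps]
noncomputable def fpCocone (X : A) : Cocone (CostructuredArrow.proj (fpι A) X ⋙ fpι A) where
  pt := X
  ι := { app := fun j => j.hom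
         naturality := fun _ _ f =>
          (CostructuredArrow.w f).trans (Category.comp_id _).symm }

/-- Every object is the canonical colimit of the finitely presentable objects over it. -/
noncomputable def isColimitFpCocone (X : A) : IsColimit (fpCocone X) :=
  ((fpι A).denseAt X).ofIsoColimit (Cocone.ext (Iso.refl _) fun _ =>
    (Category.comp_id _).trans (Category.id_comp _))

lemma FP.hom_ext {X Y : A} {f g : X ⟶ Y} (h : ∀ (s : FP A) (z : s.obj ⟶ X), z ≫ f = z ≫ g) :
    f = g :=
  (isColimitFpCocone X).hom_ext fun j => h j.left j.hom

/-- Density of `fpι`: a natural family on generalized elements is a cocone on the canonical diagram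
of X. Together with `FP.hom_ext`, this allows morphisms to be defined and compared elementwise. -/
lemma FP.exists_hom {X Y : A} (φ : ∀ s : FP A, (s.obj ⟶ X) → (s.obj ⟶ Y))
    (hφ : ∀ (s t : FP A) (c : s.obj ⟶ t.obj) (z : t.obj ⟶ X), φ s (c ≫ z) = c ≫ φ t z) :
    ∃ f : X ⟶ Y, ∀ (s : FP A) (z : s.obj ⟶ X), z ≫ f = φ s z := by
  let c : Cocone (CostructuredArrow.proj (fpι A) X ⋙ fpι A) :=
    { pt := Y
      ι := { app := fun j => φ j.left j.hom
             naturality := fun j k g => by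
              have := hφ _ _ ((fpι A).map g.left) k.hom
              rw [CostructuredArrow.w g] at this
              exact this.symm.trans (Category.comp_id _).symm } }
  exact ⟨(isColimitFpCocone X).desc c, fun s z =>
    (isColimitFpCocone X).fac c (CostructuredArrow.mk z)⟩

lemma FP.exists_factor {X : A} {s t : FP A} (z : s.obj ⟶ X) (y : t.obj ⟶ X) :
    ∃ (r : FP A) (a : s.obj ⟶ r.obj) (b : t.obj ⟶ r.obj) (w : r.obj ⟶ X),
      a ≫ w = z ∧ b ≫ w = y := by
  obtain ⟨k, f, g, -⟩ := IsFilteredOrEmpty.cocone_objs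
    (CostructuredArrow.mk (S := fpι A) z) (CostructuredArrow.mk (S := fpι A) y)
  exact ⟨k.left, (fpι A).map f.left, (fpι A).map g.left, k.hom, CostructuredArrow.w f,
    CostructuredArrow.w g⟩

lemma FP.exists_coeq {X : A} {s t : FP A} (a b : s.obj ⟶ t.obj) (z : t.obj ⟶ X)
    (h : a ≫ z = b ≫ z) :
    ∃ (r : FP A) (g : t.obj ⟶ r.obj) (w : r.obj ⟶ X), g ≫ w = z ∧ a ≫ g = b ≫ g := by
  let p := CostructuredArrow.mk (S := fpι A) (a ≫ z)
  let q := CostructuredArrow.mk (S := fpι A) z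
  let α : p ⟶ q := CostructuredArrow.homMk ((fpι A).preimage a) (by simp [p, q])
  let β : p ⟶ q := CostructuredArrow.homMk ((fpι A).preimage b) (by simp [p, q, h])
  obtain ⟨k, g, hg⟩ := IsFilteredOrEmpty.cocone_maps α β
  refine ⟨k.left, (fpι A).map g.left, k.hom, CostructuredArrow.w g, ?_⟩
  have := congr_arg (fun m => (fpι A).map (CommaMorphism.left m)) hg
  simpa [α, β] using this

lemma FP.isIso_of_bijective {X Y : A} (f : X ⟶ Y)
    (hf : ∀ s : FP A, Function.Bijective (fun z : s.obj ⟶ X => z ≫ f)) : IsIso f := by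
  choose inv hinv using fun (s : FP A) (y : s.obj ⟶ Y) => (hf s).2 y
  dsimp at hinv
  obtain ⟨g, hg⟩ := FP.exists_hom inv (fun s t c z => (hf s).1 (by simp [hinv]))
  refine ⟨g, FP.hom_ext fun s z => (hf s).1 ?_, FP.hom_ext fun s z => ?_⟩
  · simp only [← Category.assoc, hg, hinv, Category.comp_id]
  · simp [reassoc_of% hg, hinv]

variable (A) in
/-- A presheaf of sets on the finitely presentable objects. -/
structure FPPresheaf where
  /-- the values -/
  obj : FP A → Type v
  /-- the contravariant action of morphisms -/
  act : ∀ {s t : FP A}, (s.obj ⟶ t.obj) → obj t → obj s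
  act_id : ∀ {s : FP A} (p : obj s), act (𝟙 s.obj) p = p
  act_comp : ∀ {r s t : FP A} (b : r.obj ⟶ s.obj) (c : s.obj ⟶ t.obj) (p : obj t),
    act (b ≫ c) p = act b (act c p)

/-- The elements of a presheaf on the finitely presentable objects. -/
structure FPPresheaf.Elt (P : FPPresheaf A) where
  /-- the finitely presentable object -/
  s : FP A
  /-- the element -/
  p : P.obj s

@[simps]
noncomputable instance (P : FPPresheaf A) : SmallCategory P.Elt where
  Hom x y := { c : x.s ⟶ y.s // P.act ((fpι A).map c) y.p = x.p }
  id x := ⟨𝟙 x.s, by rw [CategoryTheory.Functor.map_id, P.act_id]⟩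
  comp f g := ⟨f.1 ≫ g.1, by rw [Functor.map_comp, P.act_comp, g.2, f.2]⟩

/-- The diagram whose colimit represents the presheaf. -/
@[simps]
noncomputable def FPPresheaf.diagram (P : FPPresheaf A) : P.Elt ⥤ A where
  obj x := x.s.obj
  map f := (fpι A).map f.1

/-- The presheaf is the colimit of representables over its category of elements. When that category
is filtered, the same colimit taken in A is preserved by Hom(s, -), so it has P as its presheaf of
elements. -/
lemma FPPresheaf.exists_representing (P : FPPresheaf A) [IsFiltered P.Elt] :
    ∃ (C : A) (φ : ∀ s : FP A, P.obj s → (s.obj ⟶ C)),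
      (∀ s, Function.Bijective (φ s)) ∧
      ∀ (s t : FP A) (c : s.obj ⟶ t.obj) (p : P.obj t), φ s (P.act c p) = c ≫ φ t p := by
  let φ : ∀ s : FP A, P.obj s → (s.obj ⟶ colimit P.diagram) :=
    fun s p => colimit.ι P.diagram ⟨s, p⟩
  have hφ : ∀ (s t : FP A) (c : s.obj ⟶ t.obj) (p : P.obj t),
      φ s (P.act c p) = c ≫ φ t p := by
    intro s t c p
    let m : (⟨s, P.act c p⟩ : P.Elt) ⟶ ⟨t, p⟩ := ⟨(fpι A).preimage c, by simp⟩
    have := colimit.w P.diagram m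
    simpa [m] using! this.symm
  refine ⟨colimit P.diagram, φ, fun s => ⟨fun p q hpq => ?_, fun z => ?_⟩, hφ⟩
  -- Elements with the same image are carried into a common (k, k.p) by arrows with the same
  -- underlying morphism; both are then the restriction of k.p along it.
  · obtain ⟨k, f, g, h⟩ := IsFinitelyPresentable.exists_eq_of_isColimit
      (colimit.isColimit P.diagram) (X := s.obj) (i := ⟨s, p⟩) (j := ⟨s, q⟩) (𝟙 _) (𝟙 _)
      ((Category.id_comp _).trans (Eq.trans hpq (Category.id_comp _).symm))
    have h' : f.1 = g.1 := (fpι A).map_injective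
      ((Category.id_comp _).symm.trans (Eq.trans h (Category.id_comp _)))
    have hf := f.2
    have hg := g.2
    rw [h'] at hf
    exact hf.symm.trans hg
  · obtain ⟨k, c, hc⟩ := IsFinitelyPresentable.exists_hom_of_isColimit
      (colimit.isColimit P.diagram) z
    exact ⟨P.act c k.p, (hφ _ _ c k.p).trans hc⟩

lemma FPPresheaf.isFiltered (P : FPPresheaf A) (h₀ : ∃ s, Nonempty (P.obj s))
    (h₁ : ∀ (s t : FP A) (p : P.obj s) (q : P.obj t), ∃ (r : FP A) (a : s.obj ⟶ r.obj)
      (b : t.obj ⟶ r.obj) (w : P.obj r), P.act a w = p ∧ P.act b w = q)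
    (h₂ : ∀ (s t : FP A) (a b : s.obj ⟶ t.obj) (q : P.obj t), P.act a q = P.act b q →
      ∃ (r : FP A) (g : t.obj ⟶ r.obj) (w : P.obj r), P.act g w = q ∧ a ≫ g = b ≫ g) :
    IsFiltered P.Elt where
  nonempty := let ⟨s, ⟨p⟩⟩ := h₀; ⟨⟨s, p⟩⟩
  cocone_objs x y := by
    obtain ⟨r, a, b, w, ha, hb⟩ := h₁ _ _ x.p y.p
    exact ⟨⟨r, w⟩, ⟨(fpι A).preimage a, by simpa using ha⟩,
      ⟨(fpι A).preimage b, by simpa using hb⟩, trivial⟩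
  cocone_maps x y f g := by
    obtain ⟨r, c, w, hw, hc⟩ := h₂ _ _ ((fpι A).map f.1) ((fpι A).map g.1) y.p
      (f.2.trans g.2.symm)
    refine ⟨⟨r, w⟩, ⟨(fpι A).preimage c, by simpa using hw⟩, Subtype.ext ?_⟩
    exact (fpι A).map_injective (by simpa using hc)

end FP

/-! ### Criteria for finite presentability. -/

section Presentable

variable {C : Type u} [Category.{v} C]

lemma isFinitelyPresentable_of_exists {X : C}
    (h₁ : ∀ (J : Type v) [SmallCategory J] [IsFiltered J] (D : J ⥤ C) (c : Cocone D),
      IsColimit c → ∀ f : X ⟶ c.pt, ∃ (j : J) (g : X ⟶ D.obj j), g ≫ c.ι.app j = f)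
    (h₂ : ∀ (J : Type v) [SmallCategory J] [IsFiltered J] (D : J ⥤ C) (c : Cocone D),
      IsColimit c → ∀ (j : J) (f g : X ⟶ D.obj j), f ≫ c.ι.app j = g ≫ c.ι.app j →
        ∃ (k : J) (a : j ⟶ k), f ≫ D.map a = g ≫ D.map a) :
    IsFinitelyPresentable.{v} X := by
  rw [isFinitelyPresentable_iff_preservesFilteredColimitsOfSize]
  refine ⟨fun J _ _ => ⟨fun {D} => ⟨fun {c} hc => ⟨?_⟩⟩⟩⟩
  refine Types.FilteredColimit.isColimitOf _ _ (fun f => ?_) (fun i j f g h => ?_)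
  · obtain ⟨j, g, hg⟩ := h₁ J D c hc f
    exact ⟨j, g, hg.symm⟩
  · obtain ⟨k, a, ha⟩ := h₂ J D c hc (IsFiltered.max i j)
      (f ≫ D.map (IsFiltered.leftToMax i j)) (g ≫ D.map (IsFiltered.rightToMax i j))
      (by simpa using! h)
    exact ⟨k, IsFiltered.leftToMax i j ≫ a, IsFiltered.rightToMax i j ≫ a, by simpa using! ha⟩

lemma exists_eq_of_isFinitelyPresentable {J : Type v} [SmallCategory J] [IsFiltered J] {D : J ⥤ C}
    {c : Cocone D} (hc : IsColimit c) {X : C} [IsFinitelyPresentable.{v} X] {j : J}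
    (f g : X ⟶ D.obj j) (h : f ≫ c.ι.app j = g ≫ c.ι.app j) :
    ∃ (k : J) (a : j ⟶ k), f ≫ D.map a = g ≫ D.map a := by
  obtain ⟨k, a, b, h⟩ := IsFinitelyPresentable.exists_eq_of_isColimit hc f g h
  refine ⟨IsFiltered.coeq a b, a ≫ IsFiltered.coeqHom a b, ?_⟩
  rw [D.map_comp, reassoc_of% h, ← D.map_comp, ← D.map_comp, IsFiltered.coeq_condition]

lemma isFinitelyPresentable_of_isZero {X : C} (hX : IsZero X) : IsFinitelyPresentable.{v} X :=
  isFinitelyPresentable_of_exists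
    (fun J _ _ _ _ _ _ => ⟨(IsFiltered.nonempty : Nonempty J).some, hX.to_ _, hX.eq_of_src _ _⟩)
    (fun _ _ _ _ _ _ j _ _ _ => ⟨j, 𝟙 j, hX.eq_of_src _ _⟩)

lemma isFinitelyPresentable_biprod [Preadditive C] [HasBinaryBiproducts C] (X Y : C)
    [IsFinitelyPresentable.{v} X] [IsFinitelyPresentable.{v} Y] :
    IsFinitelyPresentable.{v} (X ⊞ Y) := by
  refine isFinitelyPresentable_of_exists (fun J _ _ D c hc f => ?_)
    (fun J _ _ D c hc j f g h => ?_)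
  · obtain ⟨i, a, ha⟩ := IsFinitelyPresentable.exists_hom_of_isColimit hc (biprod.inl ≫ f)
    obtain ⟨j, b, hb⟩ := IsFinitelyPresentable.exists_hom_of_isColimit hc (biprod.inr ≫ f)
    refine ⟨IsFiltered.max i j, biprod.desc (a ≫ D.map (IsFiltered.leftToMax i j))
      (b ≫ D.map (IsFiltered.rightToMax i j)), ?_⟩
    ext <;> simp [ha, hb]
  · obtain ⟨k, a, ha⟩ := exists_eq_of_isFinitelyPresentable hc (biprod.inl ≫ f) (biprod.inl ≫ g)
      (by simp [h])
    obtain ⟨l, b, hb⟩ := exists_eq_of_isFinitelyPresentable hc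
      (biprod.inr ≫ f ≫ D.map a) (biprod.inr ≫ g ≫ D.map a) (by simp [h])
    refine ⟨l, a ≫ b, ?_⟩
    rw [Category.assoc, Category.assoc] at ha
    ext
    · simp [reassoc_of% ha]
    · simpa using hb

end Presentable

open scoped ZeroObject in
lemma FP.exists_isZero (A : Type u) [Category.{v} A] [IsFinitelyAccessibleCategory.{v} A]
    [HasZeroObject A] : ∃ s : FP A, IsZero s.obj := by
  have := isFinitelyPresentable_of_isZero (isZero_zero A)
  obtain ⟨s, ⟨e⟩⟩ := FP.exists_iso (0 : A)
  exact ⟨s, (isZero_zero A).of_iso e⟩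

/-! ### Pure exact sequences, pure subobjects and pure quotients. -/

section Additive

variable {A : Type u} [Category.{v} A] [Preadditive A] [IsFinitelyAccessibleCategory.{v} A]

/-- Flatness of Hom(-, X): a relation satisfied by an element is already satisfied at a finitely
presentable stage through which the element factors. -/
lemma FP.exists_kill {X : A} {s t : FP A} (c : s.obj ⟶ t.obj) (z : t.obj ⟶ X)
    (h : c ≫ z = 0) :
    ∃ (r : FP A) (g : t.obj ⟶ r.obj) (w : r.obj ⟶ X), g ≫ w = z ∧ c ≫ g = 0 := by
  obtain ⟨r, g, w, hw, hg⟩ := FP.exists_coeq c 0 z (by simp [h])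
  exact ⟨r, g, w, hw, by simpa using hg⟩

lemma FP.exists_biprod [HasBinaryBiproducts A] (s t : FP A) :
    ∃ r : FP A, Nonempty (r.obj ≅ s.obj ⊞ t.obj) :=
  have := isFinitelyPresentable_biprod s.obj t.obj
  FP.exists_iso _

/-- A short complex which is exact on morphisms from finitely presentable objects. -/
structure PureExact (S : ShortComplex A) : Prop where
  mono : ∀ (s : FP A) (z : s.obj ⟶ S.X₁), z ≫ S.f = 0 → z = 0
  exact : ∀ (s : FP A) (z : s.obj ⟶ S.X₂), z ≫ S.g = 0 → ∃ y, y ≫ S.f = z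
  epi : ∀ (s : FP A) (z : s.obj ⟶ S.X₃), ∃ y, y ≫ S.g = z

/-- Pure monomorphisms. -/
def IsPureMono {X Y : A} (f : X ⟶ Y) : Prop :=
  ∀ (s t : FP A) (c : s.obj ⟶ t.obj) (x : s.obj ⟶ X) (y : t.obj ⟶ Y), x ≫ f = c ≫ y →
    ∃ x' : t.obj ⟶ X, c ≫ x' = x

/-- The image of y in the quotient is killed by c, hence factors through some g with c ≫ g = 0.
Lifting that factorization corrects y to an element of the subobject without changing c ≫ y. -/
lemma PureExact.isPureMono {S : ShortComplex A} (hS : PureExact S) : IsPureMono S.f := by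
  intro s t c x y h
  obtain ⟨r, g, w, hw, hg⟩ := FP.exists_kill c (y ≫ S.g) (by
    rw [← reassoc_of% h, S.zero, comp_zero])
  obtain ⟨w', hw'⟩ := hS.epi r w
  obtain ⟨x', hx'⟩ := hS.exact t (y - g ≫ w') (by simp [hw', hw])
  refine ⟨x', sub_eq_zero.1 (hS.mono _ _ ?_)⟩
  simp [hx', reassoc_of% hg, h]

variable [HasFiniteBiproducts A]

attribute [local instance] hasBinaryBiproducts_of_finite_biproducts

/-- `hflat` is flatness of the subfunctor W. It supplies the coequalizing arrows in the category of
elements; biproducts supply the upper bounds. -/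
lemma exists_subobject (X : A) (W : ∀ s : FP A, AddSubgroup (s.obj ⟶ X))
    (hW : ∀ (s t : FP A) (c : s.obj ⟶ t.obj) (z : t.obj ⟶ X), z ∈ W t → c ≫ z ∈ W s)
    (hflat : ∀ (s t : FP A) (c : s.obj ⟶ t.obj) (z : t.obj ⟶ X), z ∈ W t → c ≫ z = 0 →
      ∃ (r : FP A) (g : t.obj ⟶ r.obj) (w : r.obj ⟶ X), w ∈ W r ∧ g ≫ w = z ∧ c ≫ g = 0) :
    ∃ (K : A) (k : K ⟶ X), (∀ (s : FP A) (z : s.obj ⟶ K), z ≫ k = 0 → z = 0) ∧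
      ∀ (s : FP A) (z : s.obj ⟶ X), z ∈ W s ↔ ∃ y : s.obj ⟶ K, y ≫ k = z := by
  let P : FPPresheaf A :=
    { obj := fun s => W s
      act := fun {s t} c z => ⟨c ≫ z.1, hW s t c _ z.2⟩
      act_id := by simp
      act_comp := by simp }
  have : IsFiltered P.Elt := by
    refine P.isFiltered (let ⟨s, _⟩ := FP.exists_isZero A; ⟨s, ⟨0⟩⟩) ?_ ?_
    · rintro s t ⟨p, hp⟩ ⟨q, hq⟩
      obtain ⟨r, ⟨e⟩⟩ := FP.exists_biprod s t
      refine ⟨r, biprod.inl ≫ e.inv, biprod.inr ≫ e.inv, ⟨(e.hom ≫ biprod.fst) ≫ p +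
        (e.hom ≫ biprod.snd) ≫ q, (W r).add_mem (hW _ _ _ _ hp) (hW _ _ _ _ hq)⟩, ?_, ?_⟩
      · exact Subtype.ext (show (biprod.inl ≫ e.inv) ≫ ((e.hom ≫ biprod.fst) ≫ p +
          (e.hom ≫ biprod.snd) ≫ q) = p by simp)
      · exact Subtype.ext (show (biprod.inr ≫ e.inv) ≫ ((e.hom ≫ biprod.fst) ≫ p +
          (e.hom ≫ biprod.snd) ≫ q) = q by simp)
    · rintro s t a b ⟨q, hq⟩ h
      obtain ⟨r, g, w, hw, h₁, h₂⟩ := hflat s t (a - b) q hq (by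
        rw [Preadditive.sub_comp, sub_eq_zero]
        exact congr_arg Subtype.val h)
      exact ⟨r, g, ⟨w, hw⟩, Subtype.ext h₁, by simpa [sub_eq_zero] using h₂⟩
  obtain ⟨K, φ, hφ, hφ'⟩ := P.exists_representing
  choose ψ hψ using fun s => (hφ s).2
  obtain ⟨k, hk⟩ := FP.exists_hom (X := K) (Y := X) (fun s z => (ψ s z).1) (fun s t c z => by
    have : ψ s (c ≫ z) = P.act c (ψ t z) := (hφ s).1 (by rw [hφ', hψ, hψ])
    exact congr_arg Subtype.val this)
  refine ⟨K, k, fun s z hz => ?_, fun s z => ⟨fun hz => ⟨φ s ⟨z, hz⟩, ?_⟩, ?_⟩⟩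
  · have h₀ : ψ s z = ψ s 0 := Subtype.ext (by rw [← hk, ← hk, hz, zero_comp])
    rw [← hψ s z, h₀, hψ]
  · rw [hk]
    exact congr_arg Subtype.val ((hφ s).1 (hψ s (φ s ⟨z, hz⟩)))
  · rintro ⟨y, rfl⟩
    rw [hk]
    exact (ψ s y).2

/-- Here `hflat` is flatness of the quotient functor Hom(-, X)/W, phrased with representatives; that
functor is then represented by C. -/
lemma exists_quotient (X : A) (W : ∀ s : FP A, AddSubgroup (s.obj ⟶ X))
    (hW : ∀ (s t : FP A) (c : s.obj ⟶ t.obj) (z : t.obj ⟶ X), z ∈ W t → c ≫ z ∈ W s)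
    (hflat : ∀ (s t : FP A) (c : s.obj ⟶ t.obj) (z : t.obj ⟶ X), c ≫ z ∈ W s →
      ∃ (r : FP A) (g : t.obj ⟶ r.obj) (w : r.obj ⟶ X), g ≫ w - z ∈ W t ∧ c ≫ g = 0) :
    ∃ (C : A) (p : X ⟶ C), (∀ (s : FP A) (z : s.obj ⟶ C), ∃ y, y ≫ p = z) ∧
      ∀ (s : FP A) (z : s.obj ⟶ X), z ∈ W s ↔ z ≫ p = 0 := by
  have hmk : ∀ (s : FP A) (y z : s.obj ⟶ X),
      (QuotientAddGroup.mk y : (s.obj ⟶ X) ⧸ W s) = QuotientAddGroup.mk z ↔ z - y ∈ W s :=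
    fun s y z => by rw [QuotientAddGroup.eq, sub_eq_neg_add]
  let P : FPPresheaf A :=
    { obj := fun s => (s.obj ⟶ X) ⧸ W s
      act := fun {s t} c => Quotient.map' (fun z => c ≫ z) (fun y z h => by
        rw [QuotientAddGroup.leftRel_apply] at h ⊢
        simpa using hW s t c _ h)
      act_id := by rintro s ⟨p⟩; exact congr_arg QuotientAddGroup.mk (Category.id_comp p)
      act_comp := by
        rintro r s t b c ⟨p⟩
        exact congr_arg QuotientAddGroup.mk (Category.assoc b c p) }
  have hact : ∀ {s t : FP A} (c : s.obj ⟶ t.obj) (z : t.obj ⟶ X),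
    P.act c (QuotientAddGroup.mk z : (t.obj ⟶ X) ⧸ W t) =
      (QuotientAddGroup.mk (c ≫ z) : (s.obj ⟶ X) ⧸ W s) := fun c z => rfl
  have : IsFiltered P.Elt := by
    refine P.isFiltered (let ⟨s, _⟩ := FP.exists_isZero A; ⟨s, ⟨QuotientAddGroup.mk 0⟩⟩) ?_ ?_
    · rintro s t ⟨p⟩ ⟨q⟩
      obtain ⟨r, ⟨e⟩⟩ := FP.exists_biprod s t
      refine ⟨r, biprod.inl ≫ e.inv, biprod.inr ≫ e.inv, QuotientAddGroup.mk
        (e.hom ≫ biprod.desc p q), ?_, ?_⟩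
      · exact congr_arg QuotientAddGroup.mk (by simp)
      · exact congr_arg QuotientAddGroup.mk (by simp)
    · rintro s t a b ⟨q⟩ h
      obtain ⟨r, g, w, h₁, h₂⟩ := hflat s t (b - a) q (by
        rw [Preadditive.sub_comp]; exact (hmk _ _ _).1 h)
      refine ⟨r, g, QuotientAddGroup.mk w, ((hmk _ _ _).2 h₁).symm, ?_⟩
      rw [Preadditive.sub_comp, sub_eq_zero] at h₂
      exact h₂.symm
  obtain ⟨C, φ, hφ, hφ'⟩ := P.exists_representing
  obtain ⟨p, hp⟩ := FP.exists_hom (X := X) (Y := C) (fun s z => φ s (QuotientAddGroup.mk z))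
    (fun s t c z => by rw [← hφ', hact])
  refine ⟨C, p, fun s z => ?_, fun s z => ?_⟩
  · obtain ⟨⟨y⟩, hy⟩ := (hφ s).2 z
    exact ⟨y, (hp s y).trans hy⟩
  · rw [← zero_comp (f := p) (X := s.obj), hp, hp, (hφ s).1.eq_iff, eq_comm]
    erw [hmk]
    rw [sub_zero]

lemma IsPureMono.eq_zero {X Y : A} {f : X ⟶ Y} (hf : IsPureMono f) (s : FP A)
    (z : s.obj ⟶ X) (hz : z ≫ f = 0) : z = 0 := by
  obtain ⟨t, ht⟩ := FP.exists_isZero A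
  obtain ⟨x', rfl⟩ := hf s t 0 z 0 (by simp [hz])
  simp

lemma IsPureMono.exists_pureExact {X Y : A} {f : X ⟶ Y} (hf : IsPureMono f) :
    ∃ (Z : A) (g : Y ⟶ Z) (w : f ≫ g = 0), PureExact (ShortComplex.mk f g w) := by
  obtain ⟨Z, g, h₁, h₂⟩ := exists_quotient Y
    (fun s => (Preadditive.rightComp s.obj f).range)
    (by
      rintro s t c _ ⟨z, rfl⟩
      exact ⟨c ≫ z, Category.assoc _ _ _⟩)
    (by
      rintro s t c y ⟨x, hx⟩
      obtain ⟨x', rfl⟩ := hf s t c x y hx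
      obtain ⟨r, g, w, hw, hg⟩ := FP.exists_kill c (y - x' ≫ f) (by
        rw [Preadditive.comp_sub, sub_eq_zero, ← Category.assoc]; exact hx.symm)
      exact ⟨r, g, w, ⟨-x', (Preadditive.neg_comp _ _).trans (by rw [hw]; abel)⟩, hg⟩)
  have w : f ≫ g = 0 := FP.hom_ext fun s z => by
    rw [comp_zero, ← Category.assoc]
    exact (h₂ s _).1 ⟨z, rfl⟩
  exact ⟨Z, g, w, hf.eq_zero, fun s z hz => (h₂ s z).2 hz, h₁⟩

lemma exists_pureExact_of_surjective {Y Z : A} (g : Y ⟶ Z)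
    (hg : ∀ (s : FP A) (z : s.obj ⟶ Z), ∃ y, y ≫ g = z) :
    ∃ (X : A) (f : X ⟶ Y) (w : f ≫ g = 0), PureExact (ShortComplex.mk f g w) := by
  obtain ⟨X, f, h₁, h₂⟩ := exists_subobject Y
    (fun s => (Preadditive.rightComp s.obj g).ker)
    (by
      intro s t c z (hz : z ≫ g = 0)
      change (c ≫ z) ≫ g = 0
      rw [Category.assoc, hz, comp_zero])
    (by
      intro s t c y (hy : y ≫ g = 0) hc
      -- Two factorizations are needed: y through a with c ≫ a = 0, then w ≫ g through b with a ≫ b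
      -- = 0. Subtracting b ≫ x' moves w into the kernel and leaves a ≫ w unchanged.
      obtain ⟨r, a, w, rfl, ha⟩ := FP.exists_kill c y hc
      obtain ⟨q, b, x, hx, hb⟩ := FP.exists_kill a (w ≫ g) (by rw [← Category.assoc, hy])
      obtain ⟨x', hx'⟩ := hg q x
      refine ⟨r, a, w - b ≫ x', ?_, ?_, ha⟩
      · change (w - b ≫ x') ≫ g = 0
        simp [hx', hx]
      · simp [reassoc_of% hb])
  have w : f ≫ g = 0 := FP.hom_ext fun s z => by
    rw [comp_zero, ← Category.assoc]
    exact (h₂ s _).2 ⟨z, rfl⟩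
  exact ⟨X, f, w, h₁, fun s z hz => (h₂ s z).1 hz, hg⟩

end Additive

/-! ### The middle term of a pure exact sequence as a colimit of biproducts. -/

section

variable {A : Type u} [Category.{v} A] [Preadditive A] [IsFinitelyAccessibleCategory.{v} A]
  [HasBinaryBiproducts A] {S : ShortComplex A}

lemma PureExact.hom_ext_of_lifts (hS : PureExact S)
    (t : ∀ (s : FP A), (s.obj ⟶ S.X₃) → (s.obj ⟶ S.X₂)) (ht : ∀ s y, t s y ≫ S.g = y) {T : A}
    {m n : S.X₂ ⟶ T}
    (h : ∀ s y, biprod.desc S.f (t s y) ≫ m = biprod.desc S.f (t s y) ≫ n) : m = n := by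
  refine FP.hom_ext fun s z => ?_
  obtain ⟨v, hv⟩ := hS.exact s (z - t s (z ≫ S.g)) (by simp [ht])
  have h₁ : S.f ≫ m = S.f ≫ n := by simpa using biprod.inl ≫= h s (z ≫ S.g)
  have h₂ : t s (z ≫ S.g) ≫ m = t s (z ≫ S.g) ≫ n := by simpa using biprod.inr ≫= h s (z ≫ S.g)
  rw [← sub_add_cancel z (t s (z ≫ S.g)), ← hv]
  simp [h₁, h₂]

/-- An element z of the middle term splits as an element of X₁ plus the chosen lift of its image,
and the map is defined on the two parts. The element u measures how far the lifts t are from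
natural; `hd` is the cocone condition for the resulting triangular transition maps. -/
lemma PureExact.exists_desc (hS : PureExact S)
    (t : ∀ (s : FP A), (s.obj ⟶ S.X₃) → (s.obj ⟶ S.X₂)) (ht : ∀ s y, t s y ≫ S.g = y) {T : A}
    (d : ∀ (s : FP A), (s.obj ⟶ S.X₃) → (S.X₁ ⊞ s.obj ⟶ T))
    (hd : ∀ (s r : FP A) (c : s.obj ⟶ r.obj) (y : r.obj ⟶ S.X₃) (u : s.obj ⟶ S.X₁),
      u ≫ S.f = t s (c ≫ y) - c ≫ t r y →
        biprod.desc biprod.inl (u ≫ biprod.inl + c ≫ biprod.inr) ≫ d r y = d s (c ≫ y)) :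
    ∃ m : S.X₂ ⟶ T, ∀ s y, biprod.desc S.f (t s y) ≫ m = d s y := by
  have hmono : ∀ {s : FP A} {z w : s.obj ⟶ S.X₁}, z ≫ S.f = w ≫ S.f → z = w :=
    fun {s z w} h => sub_eq_zero.1 (hS.mono s _ (by simp [h]))
  have hu : ∀ (s r : FP A) (c : s.obj ⟶ r.obj) (y : r.obj ⟶ S.X₃), ∃ u : s.obj ⟶ S.X₁,
      u ≫ S.f = t s (c ≫ y) - c ≫ t r y := fun s r c y => hS.exact _ _ (by simp [ht])
  have hinl : ∀ (s r : FP A) (c : s.obj ⟶ r.obj) (y : r.obj ⟶ S.X₃),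
      biprod.inl ≫ d r y = biprod.inl ≫ d s (c ≫ y) := fun s r c y => by
    obtain ⟨u, hu⟩ := hu s r c y
    simp [← hd s r c y u hu]
  -- All d s y restrict to the same map on X₁, since any two elements of X₃ factor through a third.
  obtain ⟨α, hα⟩ : ∃ α : S.X₁ ⟶ T, ∀ s y, biprod.inl ≫ d s y = α := by
    obtain ⟨i⟩ : Nonempty (CostructuredArrow (fpι A) S.X₃) := IsFiltered.nonempty
    refine ⟨biprod.inl ≫ d i.left i.hom, fun s y => ?_⟩
    obtain ⟨r, a, b, w, rfl, hw⟩ := FP.exists_factor y i.hom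
    rw [← hinl, ← hw, ← hinl]
  choose v hv using fun (s : FP A) (z : s.obj ⟶ S.X₂) =>
    hS.exact s (z - t s (z ≫ S.g)) (by simp [ht])
  let φ : ∀ s : FP A, (s.obj ⟶ S.X₂) → (s.obj ⟶ T) := fun s z =>
    v s z ≫ α + biprod.inr ≫ d s (z ≫ S.g)
  -- The value of φ may be computed from any decomposition of z, not only the chosen one; naturality
  -- follows.
  have hφ : ∀ (s r : FP A) (z : s.obj ⟶ S.X₂) (y : r.obj ⟶ S.X₃) (c : s.obj ⟶ r.obj)
      (w : s.obj ⟶ S.X₁), c ≫ y = z ≫ S.g → w ≫ S.f = z - c ≫ t r y →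
        φ s z = w ≫ α + c ≫ biprod.inr ≫ d r y := by
    intro s r z y c w h₁ h₂
    obtain ⟨u, hu⟩ := hu s r c y
    have hw : w = v s z + u := hmono (by rw [Preadditive.add_comp, h₂, hv, hu, h₁]; abel)
    dsimp only [φ]
    rw [← h₁, ← hd s r c y u hu, biprod.inr_desc_assoc, hw]
    simp [hα, add_assoc]
  obtain ⟨m, hm⟩ := FP.exists_hom φ (fun s r c z => by
    rw [hφ s r (c ≫ z) (z ≫ S.g) c (c ≫ v r z) (by simp) (by simp [hv])]
    simp [φ])
  refine ⟨m, fun s y => biprod.hom_ext' _ _ ?_ ?_⟩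
  · rw [biprod.inl_desc_assoc, hα]
    refine FP.hom_ext fun r z => ?_
    rw [← Category.assoc, hm, hφ r r (z ≫ S.f) 0 0 z (by simp) (by simp)]
    simp
  · rw [biprod.inr_desc_assoc, hm, hφ s s (t s y) y (𝟙 _) 0 (by simp [ht]) (by simp)]
    simp

end

/-! ### Elementary properties of exact structures. -/

namespace ExactStructure

section Basic

variable {A : Type u} [Category.{v} A] [Preadditive A] (E : ExactStructure A)

instance : E.inflations.RespectsIso :=
  MorphismProperty.RespectsIso.of_respects_arrow_iso _ (by
    rintro i j e ⟨Z, g, w, h⟩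
    have hj : j.hom = e.inv.left ≫ i.hom ≫ e.hom.right := by simp
    have w' : j.hom ≫ e.inv.right ≫ g = 0 := by
      rw [← Arrow.w_assoc e.inv]; simp [w]
    exact ⟨Z, e.inv.right ≫ g, w', E.of_iso (ShortComplex.isoMk
      (Arrow.leftFunc.mapIso e) (Arrow.rightFunc.mapIso e) (Iso.refl Z) e.hom.w
      (by
        have : e.hom.right ≫ e.inv.right = 𝟙 _ := congr_arg Arrow.Hom.right e.hom_inv_id
        exact (Category.assoc _ _ _).symm.trans ((congrArg (· ≫ g) this).trans
          ((Category.id_comp g).trans (Category.comp_id g).symm)))) h⟩)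

instance : E.inflations.IsMultiplicative where
  id_mem X := E.inflation_id X
  comp_mem i j hi hj := E.inflation_comp i j hi hj

instance : E.inflations.IsStableUnderCobaseChange :=
  .of_forall_exists_isPullback fun i f _ hi => by
    obtain ⟨Y', f', i', h, hi'⟩ := E.inflation_pushout i f hi
    exact ⟨Y', f', i', h, hi'⟩

variable {E}

lemma conflations_of_isColimit {X Y Z : A} {i : X ⟶ Y} (hi : E.inflations i) (g : Y ⟶ Z)
    (w : i ≫ g = 0) (hg : IsColimit (CokernelCofork.ofπ g w)) :
    E.conflations (ShortComplex.mk i g w) := by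
  obtain ⟨W, p, wp, hp⟩ := hi
  obtain ⟨hp'⟩ := E.isCokernel hp
  let e : W ≅ Z := hp'.coconePointUniqueUpToIso hg
  have he : p ≫ e.hom = g := hp'.comp_coconePointUniqueUpToIso_hom hg .one
  exact E.of_iso (S := ShortComplex.mk i p wp) (T := ShortComplex.mk i g w)
    (ShortComplex.isoMk (Iso.refl _) (Iso.refl _) e (by simp) (by simp [he])) hp

lemma conflations.mono_f {S : ShortComplex A} (hS : E.conflations S) : Mono S.f :=
  let ⟨h⟩ := E.isKernel hS
  mono_of_isLimit_fork h

lemma conflations.epi_g {S : ShortComplex A} (hS : E.conflations S) : Epi S.g :=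
  let ⟨h⟩ := E.isCokernel hS
  epi_of_isColimit_cofork h

lemma conflations.exists_desc {S : ShortComplex A} (hS : E.conflations S) {T : A} (k : S.X₂ ⟶ T)
    (hk : S.f ≫ k = 0) : ∃ l : S.X₃ ⟶ T, S.g ≫ l = k :=
  let ⟨h⟩ := E.isCokernel hS
  ⟨h.desc (CokernelCofork.ofπ k hk), h.fac _ .one⟩

lemma conflations.exists_lift {S : ShortComplex A} (hS : E.conflations S) {T : A} (k : T ⟶ S.X₂)
    (hk : k ≫ S.g = 0) : ∃ l : T ⟶ S.X₁, l ≫ S.f = k :=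
  let ⟨h⟩ := E.isKernel hS
  ⟨h.lift (KernelFork.ofι k hk), h.fac _ .zero⟩

variable (E) in
-- The kernel of the identity of Y is zero, and the inclusion of X is the pushout of the inflation 0
-- → Y along 0 → X.
lemma inflations_inl [HasBinaryBiproducts A] (X Y : A) :
    E.inflations (biprod.inl : X ⟶ X ⊞ Y) := by
  obtain ⟨K, f, w, h⟩ := E.deflation_id Y
  have := conflations.mono_f h
  dsimp at this
  rw [Category.comp_id] at w
  have hK : IsZero K := (IsZero.iff_id_eq_zero K).2 ((cancel_mono f).1 (by simp [w]))
  refine E.inflations.of_isPushout (f := f) (g := hK.to_ X) (g' := biprod.inr)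
    ⟨⟨hK.eq_of_src _ _⟩, ⟨PushoutCocone.IsColimit.mk _
      (fun s => biprod.desc s.inl s.inr) ?_ ?_ ?_⟩⟩ ⟨_, _, _, h⟩
  · intro s; simp
  · intro s; simp
  · intro s m h₁ h₂
    ext <;> simp [h₁, h₂]

variable (E) in
lemma conflations_biprod [HasBinaryBiproducts A] (X Y : A) :
    E.conflations (ShortComplex.mk (biprod.inl : X ⟶ X ⊞ Y) biprod.snd (by simp)) :=
  conflations_of_isColimit (E.inflations_inl X Y) _ _
    (CokernelCofork.IsColimit.ofπ' _ _ fun k hk => ⟨biprod.inr ≫ k, by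
      ext <;> simp [hk]⟩)

end Basic

/-! ### Exact directed colimits, and pure exact sequences as conflations. -/

section DirectedColimits

variable {A : Type u} [Category.{v} A] [Preadditive A] {E : ExactStructure A}

namespace HasExactDirectedColimits

lemma isClosedUnderFilteredColimits (hE : E.HasExactDirectedColimits) (J : Type v)
    [SmallCategory J] [IsFiltered J] : E.conflations.IsClosedUnderColimitsOfShape J where
  colimitsOfShape_le := by
    obtain ⟨α, _, _, _, F, _⟩ := IsFiltered.exists_directed J
    have := hE.closed α
    exact (E.conflations.colimitsOfShape_le_of_final F).trans
      (E.conflations.colimitsOfShape_le α)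

variable [IsFinitelyAccessibleCategory.{v} A]

attribute [local instance] hasFilteredColimits_of_isFinitelyAccessible

/-- Cokernels are functorial, so a diagram of inflations extends to one of conflations, whose
colimit is computed termwise. -/
lemma isStableUnderFilteredColimits (hE : E.HasExactDirectedColimits) :
    MorphismProperty.IsStableUnderFilteredColimits.{v, v} E.inflations where
  isStableUnderColimitsOfShape J _ _ := by
    constructor
    intro X₁ X₂ c₁ c₂ h₁ h₂ f hf φ hφ
    choose Z g w hS using hf
    have hmap : ∀ {j k : J} (a : j ⟶ k), f.app j ≫ X₂.map a ≫ g k = 0 := fun {j k} a => by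
      rw [← NatTrans.naturality_assoc, w, comp_zero]
    choose m hm using fun {j k : J} (a : j ⟶ k) => conflations.exists_desc (hS j) _ (hmap a)
    dsimp at m hm
    let Q : J ⥤ A :=
      { obj := Z
        map := m
        map_id := fun j => by
          have : Epi (g j) := conflations.epi_g (hS j)
          simp [← cancel_epi (g j), hm]
        map_comp := fun {j k l} a b => by
          have : Epi (g j) := conflations.epi_g (hS j)
          simp [← cancel_epi (g j), hm, reassoc_of% hm] }
    let S : J ⥤ ShortComplex A :=
      { obj := fun j => ShortComplex.mk (f.app j) (g j) (w j)
        map := fun {j k} a =>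
          { τ₁ := X₁.map a
            τ₂ := X₂.map a
            τ₃ := m a
            comm₁₂ := f.naturality a
            comm₂₃ := (hm a).symm }
        map_id := fun j => ShortComplex.hom_ext _ _ (X₁.map_id j) (X₂.map_id j) (Q.map_id j)
        map_comp := fun {j k l} a b =>
          ShortComplex.hom_ext _ _ (X₁.map_comp a b) (X₂.map_comp a b) (Q.map_comp a b) }
    have hg : ∀ {j k : J} (a : j ⟶ k), X₂.map a ≫ g k ≫ colimit.ι Q k = g j ≫ colimit.ι Q j :=
      fun {j k} a => by rw [← reassoc_of% hm, ← colimit.w Q a]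
    let s : Cocone X₂ :=
      { pt := colimit Q
        ι := { app := fun j => g j ≫ colimit.ι Q j
               naturality := fun j k a => (hg a).trans (Category.comp_id _).symm } }
    let T : ShortComplex A := ShortComplex.mk φ (h₂.desc s) (h₁.hom_ext fun j => by
      rw [reassoc_of% hφ, h₂.fac, comp_zero]
      exact (Category.assoc _ _ _).symm.trans (by rw [w, zero_comp]))
    let c : Cocone S :=
      { pt := T
        ι := { app := fun j =>
                { τ₁ := c₁.ι.app j
                  τ₂ := c₂.ι.app j
                  τ₃ := colimit.ι Q j
                  comm₁₂ := hφ j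
                  comm₂₃ := h₂.fac s j }
               naturality := fun j k a => ShortComplex.hom_ext _ _ (c₁.ι.naturality a)
                (c₂.ι.naturality a) ((colimit.cocone Q).ι.naturality a) } }
    have := hE.isClosedUnderFilteredColimits J
    exact ⟨_, _, _, E.conflations.prop_of_isColimit (ShortComplex.isColimitOfIsColimitπ c
      h₁ h₂ (colimit.isColimit Q)) hS⟩

lemma inflations_ι_app_bot (hE : E.HasExactDirectedColimits) {J : Type v} [LinearOrder J]
    [SuccOrder J] [OrderBot J] [WellFoundedLT J] {F : J ⥤ A} (hF : E.IsInflationChain F)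
    {c : Cocone F} (hc : IsColimit c) : E.inflations (c.ι.app ⊥) := by
  have := hE.isStableUnderFilteredColimits
  have := hF.smooth
  exact E.inflations.transfiniteCompositionsOfShape_le J _
    ⟨{ F := F
       isoBot := Iso.refl _
       incl := c.ι
       isColimit := hc
       map_mem := hF.succ }⟩

variable [HasFiniteBiproducts A]

attribute [local instance] hasBinaryBiproducts_of_finite_biproducts

lemma conflations_of_pureExact (hE : E.HasExactDirectedColimits) {S : ShortComplex A}
    (hS : PureExact S) : E.conflations S := by
  have := hE.isClosedUnderFilteredColimits (CostructuredArrow (fpι A) S.X₃)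
  have hmono : ∀ {s : FP A} {z w : s.obj ⟶ S.X₁}, z ≫ S.f = w ≫ S.f → z = w :=
    fun {s z w} h => sub_eq_zero.1 (hS.mono s _ (by simp [h]))
  choose t ht using hS.epi
  have hu : ∀ {i j : CostructuredArrow (fpι A) S.X₃} (a : i ⟶ j),
      (t _ i.hom - (fpι A).map a.left ≫ t _ j.hom) ≫ S.g = 0 := fun {i j} a => by
    simp [ht]
  -- The lifts t are not natural; the discrepancy u a lies in X₁ and becomes the off-diagonal entry
  -- of the transition map, making D a functor.
  choose u hu using fun {i j : CostructuredArrow (fpι A) S.X₃} (a : i ⟶ j) =>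
    hS.exact _ _ (hu a)
  let D : CostructuredArrow (fpι A) S.X₃ ⥤ ShortComplex A :=
    { obj := fun i => ShortComplex.mk (biprod.inl : S.X₁ ⟶ S.X₁ ⊞ i.left.obj) biprod.snd (by simp)
      map := fun {i j} a =>
        { τ₁ := 𝟙 _
          τ₂ := biprod.desc biprod.inl (u a ≫ biprod.inl + (fpι A).map a.left ≫ biprod.inr)
          τ₃ := (fpι A).map a.left
          comm₁₂ := by simp
          comm₂₃ := by ext <;> simp }
      map_id := fun i => by
        have : u (𝟙 i) = 0 := hmono (by rw [hu]; simp)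
        ext <;> simp [this]
      map_comp := fun {i j k} a b => by
        have : u (a ≫ b) = u a + (fpι A).map a.left ≫ u b :=
          hmono (by rw [hu, Preadditive.add_comp, hu, Category.assoc, hu]; simp)
        ext <;> simp [this] }
  let c : Cocone D :=
    { pt := S
      ι := { app := fun i =>
              { τ₁ := 𝟙 _
                τ₂ := biprod.desc S.f (t _ i.hom)
                τ₃ := i.hom
                comm₁₂ := by simp [D]
                comm₂₃ := by dsimp [D]; ext <;> simp [ht] }
             naturality := fun i j a => ShortComplex.hom_ext _ _ (by simp [D])
              (by dsimp [D]; apply biprod.hom_ext' <;> simp [hu])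
              ((CostructuredArrow.w a).trans (Category.comp_id _).symm) } }
  have hex : ∀ d : Cocone (D ⋙ ShortComplex.π₂), ∃ m : S.X₂ ⟶ d.pt,
      ∀ s y, biprod.desc S.f (t s y) ≫ m = d.ι.app (CostructuredArrow.mk y) := by
    intro d
    refine hS.exists_desc t ht (fun s y => d.ι.app (CostructuredArrow.mk y)) ?_
    intro s r c y v hv
    let a : CostructuredArrow.mk (c ≫ y) ⟶ CostructuredArrow.mk y :=
      CostructuredArrow.homMk ((fpι A).preimage c) (by simp)
    have ha : (fpι A).map a.left = c := (fpι A).map_preimage c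
    have hv' : v = u a := hmono (by rw [hv, hu, ha]; rfl)
    have h : biprod.desc biprod.inl (v ≫ biprod.inl + c ≫ biprod.inr) =
        (D ⋙ ShortComplex.π₂).map a := by
      obtain rfl : u a = v := hv'.symm
      exact congrArg (fun x : s.obj ⟶ r.obj => biprod.desc biprod.inl
        (HAdd.hAdd (α := s.obj ⟶ S.X₁ ⊞ r.obj) (β := s.obj ⟶ S.X₁ ⊞ r.obj)
          (γ := s.obj ⟶ S.X₁ ⊞ r.obj) (u a ≫ biprod.inl) (x ≫ biprod.inr))) ha.symm
    exact (congrArg (· ≫ _) h).trans (d.w a)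
  choose m hm using hex
  have h₂ : IsColimit (ShortComplex.π₂.mapCocone c) :=
    { desc := m
      fac := fun d i => hm d _ i.hom
      uniq := fun d n hn => hS.hom_ext_of_lifts t ht fun s y =>
        (hn (CostructuredArrow.mk y)).trans (hm d s y).symm }
  -- Connectedness makes X₁ the colimit of the constant diagram of first terms.
  have := IsFiltered.isConnected (CostructuredArrow (fpι A) S.X₃)
  exact E.conflations.prop_of_isColimit (ShortComplex.isColimitOfIsColimitπ c
    (isColimitConstCocone _ _) h₂ (isColimitFpCocone S.X₃)) fun i => E.conflations_biprod _ _

end HasExactDirectedColimits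

end DirectedColimits

end ExactStructure

/-! ### Weak idempotent completeness, smallness and a generator. -/

section Efficient

variable {A : Type u} [Category.{v} A] [IsFinitelyAccessibleCategory.{v} A]

lemma isPureMono_of_isSplitMono {X Y : A} (f : X ⟶ Y) [IsSplitMono f] : IsPureMono f :=
  fun s t c x y h => ⟨y ≫ retraction f, by rw [← reassoc_of% h, IsSplitMono.id, Category.comp_id]⟩

variable [Preadditive A]

lemma isSmallObject (E : ExactStructure A) (X : A) : E.IsSmallObject X := by
  have : IsAccessibleCategory.{v} A := ⟨_, Cardinal.fact_isRegular_aleph0, inferInstance⟩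
  obtain ⟨κ, hκ, h⟩ := (inferInstance : IsPresentable.{v} X).exists_cardinal
  have : IsCardinalPresentable X κ := h
  refine ⟨κ, hκ, fun J _ _ _ _ _ _ F _ => ?_⟩
  have := preservesColimitsOfShape_of_isCardinalPresentable X κ J
  infer_instance

variable [HasFiniteBiproducts A]

attribute [local instance] hasFilteredColimits_of_isFinitelyAccessible

variable (A) in
lemma hasCoproducts_of_isFinitelyAccessible : HasCoproducts.{v} A :=
  hasCoproducts_of_finite_and_filtered

attribute [local instance] hasCoproducts_of_isFinitelyAccessible

lemma exists_coproduct_surjective (X : A) :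
    ∃ (p : (∐ fun _ : ((∐ fun s : FP A => s.obj) ⟶ X) => (∐ fun s : FP A => s.obj)) ⟶ X),
      ∀ (s : FP A) (z : s.obj ⟶ X), ∃ y, y ≫ p = z := by
  classical
  refine ⟨Sigma.desc fun f => f, fun s z => ?_⟩
  -- The map z extended by zero to the other summands; z then lifts through the copy indexed by f.
  let f : (∐ fun s : FP A => s.obj) ⟶ X :=
    Sigma.desc fun t => if h : t = s then eqToHom (by rw [h]) ≫ z else 0
  refine ⟨Sigma.ι (fun s : FP A => s.obj) s ≫
    Sigma.ι (fun _ : ((∐ fun s : FP A => s.obj) ⟶ X) => (∐ fun s : FP A => s.obj)) f, ?_⟩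
  simp [f]

lemma ExactStructure.HasExactDirectedColimits.isEfficient {E : ExactStructure A}
    (hE : E.HasExactDirectedColimits) : E.IsEfficient where
  weaklyIdempotentComplete s _ := by
    obtain ⟨Z, g, w, h⟩ := (isPureMono_of_isSplitMono s).exists_pureExact
    obtain ⟨hc⟩ := E.isCokernel (hE.conflations_of_pureExact h)
    exact ⟨⟨_, hc⟩⟩
  transfiniteComposition J _ _ _ _ F hF :=
    ⟨inferInstance, fun _ hc => hE.inflations_ι_app_bot hF hc⟩
  small := isSmallObject E
  generator := by
    refine ⟨∐ fun s : FP A => s.obj, fun X => ?_⟩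
    obtain ⟨p, hp⟩ := exists_coproduct_surjective X
    obtain ⟨K, k, w, h⟩ := exists_pureExact_of_surjective p hp
    exact ⟨_, _, p, ⟨colimit.isColimit _⟩, K, k, w, hE.conflations_of_pureExact h⟩

end Efficient

/-! ### Pure subobjects as sets of generalized elements. -/

section PureSubobjects

variable {A : Type u} [Category.{v} A] [IsFinitelyAccessibleCategory.{v} A] [Preadditive A]

/-- The generalized elements of an object defined on finitely presentable objects. -/
abbrev FPElement (X : A) : Type v := Σ s : FP A, (s.obj ⟶ X)

/-- The sets of generalized elements which come from pure subobjects. -/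
structure IsPureSet {X : A} (W : Set (FPElement X)) : Prop where
  zero (s : FP A) : ⟨s, 0⟩ ∈ W
  sub {s : FP A} {y z : s.obj ⟶ X} : ⟨s, y⟩ ∈ W → ⟨s, z⟩ ∈ W → ⟨s, y - z⟩ ∈ W
  comp {s t : FP A} (c : s.obj ⟶ t.obj) {z : t.obj ⟶ X} : ⟨t, z⟩ ∈ W → ⟨s, c ≫ z⟩ ∈ W
  solve {s t : FP A} (c : s.obj ⟶ t.obj) (z : t.obj ⟶ X) : ⟨s, c ≫ z⟩ ∈ W →
    ∃ y : t.obj ⟶ X, ⟨t, y⟩ ∈ W ∧ c ≫ y = c ≫ z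

/-- The set of generalized elements of a subobject. -/
def elementsOf {K X : A} (k : K ⟶ X) : Set (FPElement X) := {z | ∃ y, y ≫ k = z.2}

lemma IsPureMono.isPureSet {K X : A} {k : K ⟶ X} (hk : IsPureMono k) :
    IsPureSet (elementsOf k) where
  zero s := ⟨0, by simp⟩
  sub := by
    intro s y z ⟨(y' : s.obj ⟶ K), (hy : y' ≫ k = y)⟩ ⟨(z' : s.obj ⟶ K), (hz : z' ≫ k = z)⟩
    exact ⟨y' - z', by rw [Preadditive.sub_comp, hy, hz]⟩
  comp := by
    intro s t c z ⟨(z' : t.obj ⟶ K), (hz : z' ≫ k = z)⟩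
    exact ⟨c ≫ z', by rw [Category.assoc, hz]⟩
  solve := by
    rintro s t c z ⟨y, hy⟩
    obtain ⟨x, rfl⟩ := hk s t c y z hy
    exact ⟨x ≫ k, ⟨x, rfl⟩, by rw [← Category.assoc]; exact hy⟩

lemma isPureSet_zero (X : A) : IsPureSet {z : FPElement X | z.2 = 0} where
  zero s := rfl
  sub := by
    intro s y z (hy : y = 0) (hz : z = 0)
    exact hy ▸ hz ▸ sub_self _
  comp := by
    intro s t c z (hz : z = 0)
    exact hz ▸ comp_zero
  solve := fun c z h => ⟨0, rfl, comp_zero.trans (Eq.symm h)⟩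

lemma isPureSet_sUnion {X : A} {M : Set (Set (FPElement X))} (hM : M.Nonempty)
    (hdir : DirectedOn (· ⊆ ·) M) (h : ∀ W ∈ M, IsPureSet W) : IsPureSet (⋃₀ M) where
  zero s := let ⟨W, hW⟩ := hM; ⟨W, hW, (h W hW).zero s⟩
  sub := by
    rintro s y z ⟨W, hW, hy⟩ ⟨W', hW', hz⟩
    obtain ⟨V, hV, h₁, h₂⟩ := hdir W hW W' hW'
    exact ⟨V, hV, (h V hV).sub (h₁ hy) (h₂ hz)⟩
  comp := by
    rintro s t c z ⟨W, hW, hz⟩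
    exact ⟨W, hW, (h W hW).comp c hz⟩
  solve := by
    rintro s t c z ⟨W, hW, hz⟩
    obtain ⟨y, hy, e⟩ := (h W hW).solve c z hz
    exact ⟨y, ⟨W, hW, hy⟩, e⟩

variable [HasFiniteBiproducts A]

lemma IsPureMono.cancel {X Y : A} {f : X ⟶ Y} (hf : IsPureMono f) {s : FP A} {z w : s.obj ⟶ X}
    (h : z ≫ f = w ≫ f) : z = w :=
  sub_eq_zero.1 (hf.eq_zero s _ (by rw [Preadditive.sub_comp, h, sub_self]))

lemma IsPureMono.mono {X Y : A} {f : X ⟶ Y} (hf : IsPureMono f) : Mono f :=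
  ⟨fun g h e => FP.hom_ext fun s z => hf.cancel (by simp [e])⟩

lemma IsPureMono.exists_lift {K X Y : A} {k : K ⟶ X} (hk : IsPureMono k) (g : Y ⟶ X)
    (h : ∀ (s : FP A) (z : s.obj ⟶ Y), ∃ y, y ≫ k = z ≫ g) : ∃ l : Y ⟶ K, l ≫ k = g := by
  choose φ hφ using h
  obtain ⟨l, hl⟩ := FP.exists_hom φ (fun s t c z => hk.cancel (by simp [hφ]))
  exact ⟨l, FP.hom_ext fun s z => by rw [← Category.assoc, hl, hφ]⟩

/-- Closure under `solve` plays both roles: it makes the subfunctor flat, hence representable, and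
it makes the resulting monomorphism pure. -/
lemma IsPureSet.exists_isPureMono {X : A} {W : Set (FPElement X)}
    (hW : IsPureSet W) : ∃ (K : A) (k : K ⟶ X), IsPureMono k ∧ elementsOf k = W := by
  let W' (s : FP A) : AddSubgroup (s.obj ⟶ X) :=
    { carrier := {z | (⟨s, z⟩ : FPElement X) ∈ W}
      zero_mem' := show (⟨s, (0 : s.obj ⟶ X)⟩ : FPElement X) ∈ W from hW.zero s
      add_mem' := fun {y z} hy hz => by
        have : y + z = y - (0 - z) := by abel
        exact this ▸ hW.sub hy (hW.sub (hW.zero s) hz)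
      neg_mem' := fun {z} hz => zero_sub z ▸ hW.sub (hW.zero s) hz }
  obtain ⟨K, k, h₁, h₂⟩ := exists_subobject X W' (fun s t c z hz => hW.comp c hz)
    (fun s t c z hz h => by
      obtain ⟨r, g, w, rfl, hg⟩ := FP.exists_kill c z h
      obtain ⟨y, hy, hy'⟩ := hW.solve g w hz
      exact ⟨r, g, y, hy, hy', hg⟩)
  refine ⟨K, k, fun s t c x y h => ?_, Set.ext fun z => (h₂ z.1 z.2).symm⟩
  obtain ⟨y', hy', e⟩ := hW.solve c y (h ▸ (h₂ s _).2 ⟨x, rfl⟩)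
  obtain ⟨x', rfl⟩ := (h₂ t _).1 hy'
  exact ⟨x', sub_eq_zero.1 (h₁ s _ (by simp [h, e]))⟩

lemma IsPureMono.exists_lift_of_subset {K K' X : A} {k : K ⟶ X} {k' : K' ⟶ X}
    (hk' : IsPureMono k') (h : elementsOf k ⊆ elementsOf k') : ∃ l : K ⟶ K', l ≫ k' = k :=
  hk'.exists_lift k fun s z => h (a := ⟨s, z ≫ k⟩) ⟨z, rfl⟩

end PureSubobjects

/-! ### Pure subobjects of bounded size. -/

section SmallObjects

variable {A : Type u} [Category.{v} A] [IsFinitelyAccessibleCategory.{v} A]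

/-- Formal terms for the elements of the pure subobject generated by an element defined on
the finitely presentable object `s₀`. -/
inductive PureTerm (s₀ : FP A) : FP A → Type v
  | gen : PureTerm s₀ s₀
  | zero (s : FP A) : PureTerm s₀ s
  | sub {s : FP A} : PureTerm s₀ s → PureTerm s₀ s → PureTerm s₀ s
  | comp {s t : FP A} (c : s.obj ⟶ t.obj) : PureTerm s₀ t → PureTerm s₀ s
  | solve {s t : FP A} (c : s.obj ⟶ t.obj) : PureTerm s₀ s → PureTerm s₀ t

section

variable [Preadditive A]

open Classical in
/-- The interpretation of a formal term. -/
noncomputable def PureTerm.eval {X : A} {s₀ : FP A} (x : s₀.obj ⟶ X) :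
    ∀ {s : FP A}, PureTerm s₀ s → (s.obj ⟶ X)
  | _, .gen => x
  | _, .zero _ => 0
  | _, .sub a b => a.eval x - b.eval x
  | _, .comp c a => c ≫ a.eval x
  -- One solution is chosen for each solvable equation; the default 0 is harmless, since it only
  -- adds an element already present.
  | _, .solve c a => if h : ∃ y, c ≫ y = a.eval x then h.choose else 0

lemma isPureSet_range_eval {X : A} {s₀ : FP A} (x : s₀.obj ⟶ X) :
    IsPureSet {z : FPElement X | ∃ a : PureTerm s₀ z.1, a.eval x = z.2} where
  zero s := ⟨.zero s, rfl⟩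
  sub := by
    intro s y z ⟨a, (ha : a.eval x = y)⟩ ⟨b, (hb : b.eval x = z)⟩
    exact ⟨.sub a b, congrArg₂ (fun y z : s.obj ⟶ X => y - z) ha hb⟩
  comp := by
    intro s t c z ⟨a, (ha : a.eval x = z)⟩
    exact ⟨.comp c a, congrArg (c ≫ ·) ha⟩
  solve := by
    rintro s t c z ⟨a, ha⟩
    have h : ∃ y, c ≫ y = a.eval x := ⟨z, ha.symm⟩
    exact ⟨h.choose, ⟨.solve c a, by rw [PureTerm.eval, dif_pos h]⟩, h.choose_spec.trans ha⟩

/-- The values of the terms form a pure set. The terms themselves depend only on s₀, so the size of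
K is bounded independently of X. -/
lemma exists_small_isPureMono [HasFiniteBiproducts A] {X : A} {s₀ : FP A} (x : s₀.obj ⟶ X) :
    ∃ (K : A) (k : K ⟶ X) (x' : s₀.obj ⟶ K), IsPureMono k ∧ x' ≫ k = x ∧
      ∃ π : ∀ s, PureTerm s₀ s → (s.obj ⟶ K), ∀ s, Function.Surjective (π s) := by
  obtain ⟨K, k, hk, e⟩ := (isPureSet_range_eval x).exists_isPureMono
  have h (s : FP A) (a : PureTerm s₀ s) : ∃ y : s.obj ⟶ K, y ≫ k = a.eval x :=
    (Set.ext_iff.1 e ⟨s, a.eval x⟩).2 ⟨a, rfl⟩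
  choose π hπ using h
  refine ⟨K, k, π _ .gen, hk, hπ _ _, π, fun s z => ?_⟩
  obtain ⟨a, ha⟩ := (Set.ext_iff.1 e ⟨s, z ≫ k⟩).1 ⟨z, rfl⟩
  exact ⟨a, hk.cancel ((hπ s a).trans ha)⟩

end

/-- `K` is presented by a relation on formal terms. -/
def IsPresentedBy {s₀ : FP A}
    (R : ∀ s t : FP A, (s.obj ⟶ t.obj) → PureTerm s₀ s → PureTerm s₀ t → Prop) (K : A) : Prop :=
  ∃ π : ∀ s, PureTerm s₀ s → (s.obj ⟶ K), (∀ s, Function.Surjective (π s)) ∧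
    ∀ s t c a b, R s t c a b ↔ π s a = c ≫ π t b

/-- The relation recovers the presheaf of elements: at c = 𝟙 it says which terms agree, and at
general c it gives the restriction maps. -/
lemma IsPresentedBy.nonempty_iso {s₀ : FP A}
    {R : ∀ s t : FP A, (s.obj ⟶ t.obj) → PureTerm s₀ s → PureTerm s₀ t → Prop} {K K' : A}
    (h : IsPresentedBy R K) (h' : IsPresentedBy R K') : Nonempty (K ≅ K') := by
  obtain ⟨π, hπ, e⟩ := h
  obtain ⟨π', hπ', e'⟩ := h'
  have key (s t : FP A) (c : s.obj ⟶ t.obj) (a b) : π s a = c ≫ π t b ↔ π' s a = c ≫ π' t b :=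
    (e s t c a b).symm.trans (e' s t c a b)
  have key' (s : FP A) (a b) : π s a = π s b ↔ π' s a = π' s b := by
    simpa using key s s (𝟙 _) a b
  choose σ hσ using hπ
  choose σ' hσ' using hπ'
  obtain ⟨f, hf⟩ := FP.exists_hom (fun s z => π' s (σ s z)) (fun s t c z =>
    (key s t c _ _).1 (by rw [hσ, hσ]))
  have : IsIso f := FP.isIso_of_bijective f fun s =>
    ⟨fun y z h => by
      dsimp only at h
      rw [hf, hf, ← key', hσ, hσ] at h
      exact h, fun z => ⟨π s (σ' s z), by
      dsimp only
      rw [hf, ← hσ' s z, ← key', hσ, hσ']⟩⟩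
  exact ⟨asIso f⟩

variable (A) in
/-- There is a set of objects such that every generalized element of every object
belongs to a pure subobject from this set. -/
lemma exists_pureSubobject_family [Preadditive A] [HasFiniteBiproducts A] :
    ∃ (D : Type v) (U : D → A), ∀ (X : A) (s : FP A) (x : s.obj ⟶ X),
      ∃ (d : D) (k : U d ⟶ X) (x' : s.obj ⟶ U d), IsPureMono k ∧ x' ≫ k = x := by
  let D₀ : Type v := Σ s₀ : FP A,
    ∀ s t : FP A, (s.obj ⟶ t.obj) → PureTerm s₀ s → PureTerm s₀ t → Prop
  -- The relations form a set; one object is chosen for each relation that is realized.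
  refine ⟨{ d : D₀ // ∃ K, IsPresentedBy d.2 K }, fun d => d.2.choose, fun X s x => ?_⟩
  obtain ⟨K, k, x', hk, hx, π, hπ⟩ := exists_small_isPureMono x
  let d : D₀ := ⟨s, fun s t c a b => π s a = c ≫ π t b⟩
  have hK : IsPresentedBy d.2 K := ⟨π, hπ, fun s t c a b => Iff.rfl⟩
  have hd : ∃ K, IsPresentedBy d.2 K := ⟨K, hK⟩
  obtain ⟨e⟩ := hd.choose_spec.nonempty_iso hK
  refine ⟨⟨d, hd⟩, e.hom ≫ k, x' ≫ e.inv, fun a b c y z h => ?_, by simp [hx]⟩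
  obtain ⟨y', hy⟩ := hk a b c (y ≫ e.hom) z (by simpa using h)
  exact ⟨y' ≫ e.inv, by simp [reassoc_of% hy]⟩

end SmallObjects

/-! ### Enlarging a pure subobject by one small piece. -/

section Steps

variable {A : Type u} [Category.{v} A] [IsFinitelyAccessibleCategory.{v} A] [Preadditive A]
  [HasFiniteBiproducts A] {D : Type v} (U : D → A)

/-- The pure subobject with elements `W'` is an extension by an object `U d` of the one with
elements `W`. -/
def IsPureStep {X : A} (W W' : Set (FPElement X)) : Prop :=
  ∀ {K K' : A} (k : K ⟶ X) (k' : K' ⟶ X), IsPureMono k → IsPureMono k' →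
    elementsOf k = W → elementsOf k' = W' → ∀ j : K ⟶ K', j ≫ k' = k →
      ∃ (d : D) (q : K' ⟶ U d) (w : j ≫ q = 0), PureExact (ShortComplex.mk j q w)

variable {U}

/-- A missing element p has an image in the quotient C = X/K, where it lies in a pure subobject U d.
The enlarged subobject is the preimage of U d, that is, the kernel of X → C/U d. -/
lemma exists_isPureStep
    (hU : ∀ (X : A) (s : FP A) (x : s.obj ⟶ X), ∃ (d : D) (k : U d ⟶ X) (x' : s.obj ⟶ U d),
      IsPureMono k ∧ x' ≫ k = x)
    {X : A} {W : Set (FPElement X)} (hW : IsPureSet W) (hne : W ≠ Set.univ) :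
    ∃ W' : Set (FPElement X), IsPureSet W' ∧ W ⊂ W' ∧ IsPureStep U W W' := by
  obtain ⟨⟨s, p⟩, hp⟩ := (Set.ne_univ_iff_exists_notMem W).1 hne
  obtain ⟨K, k, hk, rfl⟩ := hW.exists_isPureMono
  obtain ⟨C, g, w, h₁⟩ := hk.exists_pureExact
  obtain ⟨d, u, x, hu, hx⟩ := hU C s (p ≫ g)
  obtain ⟨C', g', w', h₂⟩ := hu.exists_pureExact
  obtain ⟨K', k', w'', h₃⟩ := exists_pureExact_of_surjective (g ≫ g') (fun s z => by
    obtain ⟨y, rfl⟩ := h₂.epi s z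
    obtain ⟨x, rfl⟩ := h₁.epi s y
    exact ⟨x, (Category.assoc _ _ _).symm⟩)
  have hk' : IsPureMono k' := h₃.isPureMono
  have hmem : ∀ {s : FP A} (z : s.obj ⟶ X), z ≫ g ≫ g' = 0 → ∃ y, y ≫ k' = z := fun z hz =>
    h₃.exact _ z hz
  obtain ⟨q, hq⟩ := hu.exists_lift (k' ≫ g) (fun s z => h₂.exact s (z ≫ k' ≫ g) (by
    dsimp; rw [Category.assoc, Category.assoc, w'', comp_zero]))
  refine ⟨elementsOf k', hk'.isPureSet, ⟨?_, fun h => hp (h ?_)⟩, ?_⟩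
  · rintro ⟨t, z⟩ ⟨y, hy⟩
    exact hmem z (by dsimp at hy; rw [← hy, Category.assoc, reassoc_of% w, zero_comp, comp_zero])
  · exact hmem p (by rw [← reassoc_of% hx, w', comp_zero])
  intro L L' l l' hl hl' e e' j hj
  obtain ⟨a, ha⟩ := hk'.exists_lift_of_subset e'.subset
  obtain ⟨b, hb⟩ := hl'.exists_lift_of_subset e'.symm.subset
  have hql : (a ≫ q) ≫ u = l' ≫ g := by rw [Category.assoc, hq, reassoc_of% ha]
  have hlg : l ≫ g = 0 := FP.hom_ext fun s z => by
    obtain ⟨y, hy⟩ := (Set.ext_iff.1 e ⟨s, z ≫ l⟩).1 ⟨z, rfl⟩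
    dsimp at hy
    rw [← Category.assoc, ← hy, Category.assoc, w, comp_zero, comp_zero]
  have := hu.mono
  refine ⟨d, a ≫ q, ?_, ?_, ?_, ?_⟩
  · rw [← cancel_mono u, Category.assoc, hql, reassoc_of% hj, hlg, zero_comp]
  · intro s z hz
    dsimp at hz
    exact hl.eq_zero s z (by rw [← hj, reassoc_of% hz, zero_comp])
  · intro s z hz
    dsimp at z hz ⊢
    have hz' : (z ≫ l') ≫ g = 0 := by
      rw [Category.assoc, ← hql, ← Category.assoc, hz, zero_comp]
    obtain ⟨y, hy⟩ := h₁.exact s (z ≫ l') hz'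
    obtain ⟨y', hy'⟩ := (Set.ext_iff.1 e ⟨s, z ≫ l'⟩).2 ⟨y, hy⟩
    exact ⟨y', hl'.cancel (by rw [Category.assoc, hj]; exact hy')⟩
  · intro s z
    dsimp at z ⊢
    obtain ⟨y, hy⟩ := h₁.epi s (z ≫ u)
    dsimp at y hy
    obtain ⟨y', rfl⟩ := hmem y (by rw [reassoc_of% hy, w', comp_zero])
    refine ⟨y' ≫ b, hu.cancel ?_⟩
    rw [Category.assoc, hql, Category.assoc, reassoc_of% hb, ← hy, Category.assoc]

end Steps

/-! ### Transfinite iteration of pure steps. -/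

section Chain

variable {A : Type u} [Category.{v} A] [IsFinitelyAccessibleCategory.{v} A] [Preadditive A]

/-- A transfinite sequence of sets of generalized elements, which iterates the extension of
a set by a pure step. -/
noncomputable def pureChain {X : A} (step : Set (FPElement X) → Set (FPElement X)) {J : Type v}
    [LinearOrder J] [WellFoundedLT J] : J → Set (FPElement X) :=
  WellFoundedLT.fix fun j W => {z | z.2 = 0} ∪ {z | ∃ (i : J) (h : i < j), z ∈ step (W i h)}

variable {X : A} {step : Set (FPElement X) → Set (FPElement X)} {J : Type v}
    [LinearOrder J] [WellFoundedLT J]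

lemma mem_pureChain (j : J) (z : FPElement X) :
    z ∈ pureChain step j ↔ z.2 = 0 ∨ ∃ i < j, z ∈ step (pureChain step i) := by
  rw [pureChain, WellFoundedLT.fix_eq]
  simp

lemma pureChain_subset {i j : J} (h : i < j) : step (pureChain step i) ⊆ pureChain step j :=
  fun z hz => (mem_pureChain j z).2 (.inr ⟨i, h, hz⟩)

lemma monotone_pureChain : Monotone (pureChain step : J → Set (FPElement X)) := by
  intro i j h z hz
  rw [mem_pureChain] at hz ⊢
  exact hz.imp_right fun ⟨k, hk, hz⟩ => ⟨k, hk.trans_le h, hz⟩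

lemma isPureSet_pureChain (hstep : ∀ W, W ⊆ step W) (h : ∀ W, IsPureSet W → IsPureSet (step W))
    (j : J) : IsPureSet (pureChain step j) := by
  induction j using WellFoundedLT.induction with | ind j hj =>
  let M : Set (Set (FPElement X)) :=
    insert {z | z.2 = 0} ((fun i => step (pureChain step i)) '' Set.Iio j)
  have hM : ∀ W ∈ M, IsPureSet W := by
    rintro _ (rfl | ⟨i, hi, rfl⟩)
    · exact isPureSet_zero X
    · exact h _ (hj i hi)
  have hle : ∀ i k : J, i ≤ k → step (pureChain step i) ⊆ step (pureChain step k) := by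
    rintro i k h
    rcases h.eq_or_lt with rfl | h
    · exact subset_rfl
    · exact (pureChain_subset h).trans (hstep _)
  have hzero : ∀ W ∈ M, {z : FPElement X | z.2 = 0} ⊆ W := by
    rintro W hW ⟨s, z⟩ (rfl : z = 0)
    exact (hM W hW).zero s
  have : pureChain step j = ⋃₀ M := by
    ext z
    simp [M, mem_pureChain]
  rw [this]
  refine isPureSet_sUnion ⟨_, Set.mem_insert _ _⟩ ?_ hM
  rintro W hW V hV
  rcases hW with rfl | ⟨i, hi, rfl⟩
  · exact ⟨V, hV, hzero V hV, subset_rfl⟩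
  rcases hV with rfl | ⟨k, hk, rfl⟩
  · exact ⟨_, .inr ⟨i, hi, rfl⟩, subset_rfl, hzero _ (.inr ⟨i, hi, rfl⟩)⟩
  rcases le_total i k with h | h
  · exact ⟨_, .inr ⟨k, hk, rfl⟩, hle _ _ h, subset_rfl⟩
  · exact ⟨_, .inr ⟨i, hi, rfl⟩, subset_rfl, hle _ _ h⟩

lemma pureChain_succ [SuccOrder J] (hstep : ∀ W, W ⊆ step W) {j : J} (hj : ¬ IsMax j)
    (h : ∀ W, IsPureSet W → IsPureSet (step W)) :
    pureChain step (Order.succ j) = step (pureChain step j) := by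
  refine subset_antisymm (fun z hz => ?_) (pureChain_subset (Order.lt_succ_of_not_isMax hj))
  obtain ⟨s, z⟩ := z
  rcases (mem_pureChain _ _).1 hz with (rfl : z = 0) | ⟨i, hi, hz'⟩
  · exact hstep _ ((isPureSet_pureChain hstep h j).zero s)
  · rcases ((Order.lt_succ_iff_of_not_isMax hj).1 hi).eq_or_lt with rfl | hi
    · exact hz'
    · exact hstep _ (pureChain_subset hi hz')

lemma mem_pureChain_of_isSuccLimit [SuccOrder J] (hstep : ∀ W, W ⊆ step W) {j : J}
    (hj : Order.IsSuccLimit j) (h : ∀ W, IsPureSet W → IsPureSet (step W)) {z : FPElement X}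
    (hz : z ∈ pureChain step j) : ∃ i < j, z ∈ pureChain step i := by
  obtain ⟨s, z⟩ := z
  rcases (mem_pureChain _ _).1 hz with (rfl : z = 0) | ⟨i, hi, hz⟩
  · obtain ⟨i, hi⟩ := not_isMin_iff.1 hj.not_isMin
    exact ⟨i, hi, (isPureSet_pureChain hstep h i).zero s⟩
  · exact ⟨Order.succ i, hj.succ_lt hi, pureChain_subset (Order.lt_succ_of_not_isMax
      (not_isMax_of_lt hi)) hz⟩

/-- If the chain never reached everything, each index would contribute a new element, injecting J
into the smaller set of elements. -/
lemma pureChain_top_eq_univ [OrderTop J] (hJ : Cardinal.mk (FPElement X) < Cardinal.mk J)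
    (hstep : ∀ W, W ≠ Set.univ → IsPureSet W → W ⊂ step W)
    (h : ∀ j : J, IsPureSet (pureChain step j)) :
    pureChain step (⊤ : J) = Set.univ := by
  by_contra hne
  have hne' : ∀ j : J, pureChain step j ≠ Set.univ := fun j hj =>
    hne (Set.univ_subset_iff.1 (hj ▸ monotone_pureChain le_top))
  choose f hf hf' using fun j : J => Set.exists_of_ssubset (hstep _ (hne' j) (h j))
  refine hJ.not_ge (Cardinal.mk_le_of_injective (f := f) fun i j hij => ?_)
  rcases lt_trichotomy i j with hlt | rfl | hlt
  · exact (hf' j (hij ▸ pureChain_subset hlt (hf i))).elim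
  · rfl
  · exact (hf' i (hij ▸ pureChain_subset hlt (hf j))).elim

end Chain

/-! ### The filtration by pure subobjects. -/

section

variable {A : Type u} [Category.{v} A] [IsFinitelyAccessibleCategory.{v} A]

/-- Each element of the point comes from some stage. Two representatives agree at any common later
stage by injectivity, so a cocone defines a map elementwise. -/
lemma nonempty_isColimit_of_jointly_surjective {J : Type v} [SmallCategory J] [IsFiltered J]
    {F : J ⥤ A} (c : Cocone F)
    (hinj : ∀ (j : J) (s : FP A) (y z : s.obj ⟶ F.obj j),
      y ≫ c.ι.app j = z ≫ c.ι.app j → y = z)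
    (hsurj : ∀ (s : FP A) (z : s.obj ⟶ c.pt), ∃ (j : J) (y : s.obj ⟶ F.obj j),
      y ≫ c.ι.app j = z) : Nonempty (IsColimit c) := by
  choose i y hy using hsurj
  have key (d : Cocone F) {s : FP A} {j k : J} (a : s.obj ⟶ F.obj j) (b : s.obj ⟶ F.obj k)
      (h : a ≫ c.ι.app j = b ≫ c.ι.app k) : a ≫ d.ι.app j = b ≫ d.ι.app k := by
    rw [← d.w (IsFiltered.leftToMax j k), ← d.w (IsFiltered.rightToMax j k), ← Category.assoc,
      ← Category.assoc, hinj _ _ (a ≫ F.map _) (b ≫ F.map _) (by simpa using h)]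
  have hdesc (d : Cocone F) : ∃ f : c.pt ⟶ d.pt, ∀ (s : FP A) (z : s.obj ⟶ c.pt),
      z ≫ f = y s z ≫ d.ι.app _ :=
    FP.exists_hom (fun s z => y s z ≫ d.ι.app _) fun s t a z => by
      rw [← Category.assoc]
      exact key d _ _ (by rw [hy, Category.assoc, hy])
  choose f hf using hdesc
  exact ⟨{
    desc := f
    fac := fun d j => FP.hom_ext fun s z => by
      rw [← Category.assoc, hf]
      exact key d _ _ (hy _ _)
    uniq := fun d m hm => FP.hom_ext fun s z => by
      rw [hf, ← hm, ← Category.assoc, hy] }⟩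

variable [Preadditive A] [HasFiniteBiproducts A]

lemma isPureStep_refl {D : Type v} {U : D → A}
    (hU : ∀ (X : A) (s : FP A) (x : s.obj ⟶ X), ∃ (d : D) (k : U d ⟶ X) (x' : s.obj ⟶ U d),
      IsPureMono k ∧ x' ≫ k = x) {X : A} (W : Set (FPElement X)) : IsPureStep U W W := by
  intro K K' k k' hk hk' e e' j hj
  obtain ⟨s, hs⟩ := FP.exists_isZero A
  -- The trivial step has zero quotient; a zero member of the family arises as a pure subobject of a
  -- zero object.
  obtain ⟨d, u, _, hu, -⟩ := hU s.obj s (𝟙 _)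
  refine ⟨d, 0, comp_zero, fun s z hz => ?_, fun s z hz => ?_, fun s z => ⟨0, hu.cancel ?_⟩⟩
  · dsimp at z hz
    exact hk.eq_zero s z (by rw [← hj, reassoc_of% hz, zero_comp])
  · dsimp at z ⊢
    obtain ⟨y, hy⟩ := (Set.ext_iff.1 (e.trans e'.symm) ⟨s, z ≫ k'⟩).2 ⟨z, rfl⟩
    exact ⟨y, hk'.cancel (by rw [Category.assoc, hj]; exact hy)⟩
  · exact hs.eq_of_tgt _ _

lemma exists_step {D : Type v} {U : D → A}
    (hU : ∀ (X : A) (s : FP A) (x : s.obj ⟶ X), ∃ (d : D) (k : U d ⟶ X) (x' : s.obj ⟶ U d),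
      IsPureMono k ∧ x' ≫ k = x) (X : A) :
    ∃ step : Set (FPElement X) → Set (FPElement X), (∀ W, W ⊆ step W) ∧
      (∀ W, IsPureSet W → IsPureSet (step W)) ∧
      (∀ W, IsPureSet W → IsPureStep U W (step W)) ∧
      (∀ W, W ≠ Set.univ → IsPureSet W → W ⊂ step W) := by
  have (W : Set (FPElement X)) : ∃ W' : Set (FPElement X), W ⊆ W' ∧
      (IsPureSet W → IsPureSet W') ∧ (IsPureSet W → IsPureStep U W W') ∧
      (W ≠ Set.univ → IsPureSet W → W ⊂ W') := by
    by_cases h : W ≠ Set.univ ∧ IsPureSet W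
    · obtain ⟨W', h₁, h₂, h₃⟩ := exists_isPureStep hU h.2 h.1
      exact ⟨W', h₂.subset, fun _ => h₁, fun _ => h₃, fun _ _ => h₂⟩
    · exact ⟨W, subset_rfl, id, fun _ => isPureStep_refl hU W, fun h₁ h₂ => (h ⟨h₁, h₂⟩).elim⟩
  choose step h₁ h₂ h₃ h₄ using this
  exact ⟨step, h₁, h₂, h₃, h₄⟩

/-- Every object has a filtration by pure subobjects, with successive quotients in the family `U`,
if every generalized element belongs to a pure subobject in `U`. -/
lemma exists_pureFiltration {D : Type v} {U : D → A}
    (hU : ∀ (X : A) (s : FP A) (x : s.obj ⟶ X), ∃ (d : D) (k : U d ⟶ X) (x' : s.obj ⟶ U d),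
      IsPureMono k ∧ x' ≫ k = x) (X : A) :
    ∃ (J : Type v) (_ : LinearOrder J) (_ : SuccOrder J) (_ : OrderBot J) (_ : OrderTop J)
      (_ : WellFoundedLT J) (F : J ⥤ A),
      F.IsWellOrderContinuous ∧ IsZero (F.obj ⊥) ∧ Nonempty (F.obj ⊤ ≅ X) ∧
      ∀ j : J, ¬ IsMax j → ∃ (d : D) (p : F.obj (Order.succ j) ⟶ U d)
        (w : F.map (homOfLE (Order.le_succ j)) ≫ p = 0),
        PureExact (ShortComplex.mk (F.map (homOfLE (Order.le_succ j))) p w) := by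
  -- More indices than X has elements, so the chain is exhausted; the added top carries X itself.
  let J : Type v := WithTop (Order.succ (Cardinal.mk (FPElement X))).ord.ToType
  have hJ : Cardinal.mk (FPElement X) < Cardinal.mk J :=
    (Order.lt_succ _).trans_le ((Cardinal.mk_ord_toType _).ge.trans
      (Cardinal.mk_le_of_injective (Option.some_injective _)))
  let : SuccOrder J := SuccOrder.ofLinearWellFoundedLT J
  let : OrderBot J := WellFoundedLT.toOrderBot J
  obtain ⟨step, h₁, h₂, h₃, h₄⟩ := exists_step hU X
  let W : J → Set (FPElement X) := pureChain step
  have hW : ∀ j : J, IsPureSet (W j) := isPureSet_pureChain h₁ h₂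
  choose K k hk hkW using fun j : J => (hW j).exists_isPureMono
  choose l hl using fun {i j : J} (h : i ≤ j) => (hk j).exists_lift_of_subset (k := k i)
    (by rw [hkW, hkW]; exact monotone_pureChain h)
  have hmono (j : J) : Mono (k j) := (hk j).mono
  let F : J ⥤ A :=
    { obj := K
      map := fun f => l (leOfHom f)
      map_id := fun j => by simp [← cancel_mono (k j), hl]
      map_comp := fun {i j m} f g => by simp [← cancel_mono (k m), hl] }
  have hl' {i j : J} (h : i ≤ j) {s : FP A} (y : s.obj ⟶ K i) : (y ≫ l h) ≫ k j = y ≫ k i := by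
    rw [Category.assoc, hl]
  refine ⟨J, inferInstance, inferInstance, inferInstance, inferInstance, inferInstance, F,
    ⟨fun m hm => ?_⟩, ?_, ?_, fun j hj => ?_⟩
  · have : Nonempty (Set.Iio m) := let ⟨i, hi⟩ := not_isMin_iff.1 hm.not_isMin; ⟨i, hi⟩
    refine nonempty_isColimit_of_jointly_surjective _ (fun j s y z h => ?_) (fun s z => ?_)
    · refine (hk j.1).cancel ?_
      exact (hl' j.2.le y).symm.trans ((congrArg (· ≫ k m) h).trans (hl' j.2.le z))
    · have hz : ⟨s, z ≫ k m⟩ ∈ W m := (hkW m).subset ⟨z, rfl⟩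
      obtain ⟨i, hi, hz⟩ := mem_pureChain_of_isSuccLimit h₁ hm h₂ hz
      obtain ⟨y, hy⟩ := (hkW i).symm.subset hz
      exact ⟨⟨i, hi⟩, y, (hk m).cancel ((hl' hi.le y).trans hy)⟩
  · refine (IsZero.iff_id_eq_zero _).2 (FP.hom_ext fun s z => ?_)
    have hz : ⟨s, z ≫ k ⊥⟩ ∈ W ⊥ := (hkW ⊥).subset ⟨z, rfl⟩
    rcases (mem_pureChain _ _).1 hz with h | ⟨i, hi, -⟩
    · rw [(hk ⊥).eq_zero s z h, zero_comp, zero_comp]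
    · exact (not_lt_bot hi).elim
  · have htop : W ⊤ = Set.univ := pureChain_top_eq_univ hJ h₄ hW
    have : IsIso (k ⊤) := FP.isIso_of_bijective _ fun s =>
      ⟨fun y z h => (hk ⊤).cancel h, fun z => by
        obtain ⟨y, hy⟩ := (Set.ext_iff.1 ((hkW ⊤).trans htop) ⟨s, z⟩).2 trivial
        exact ⟨y, hy⟩⟩
    exact ⟨asIso (k ⊤)⟩
  · exact h₃ _ (hW j) _ _ (hk _) (hk _) (hkW _)
      ((hkW _).trans (pureChain_succ h₁ hj h₂)) _ (hl _)

end

/-! ### Grothendieck type, and reduction of the locally coherent case. -/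

namespace ExactStructure

variable {A : Type u} [Category.{v} A] [Preadditive A]
  [IsFinitelyAccessibleCategory.{v} A] {E : ExactStructure A}

lemma HasExactDirectedColimits.isOfGrothendieckType [HasFiniteBiproducts A]
    (hE : E.HasExactDirectedColimits) :
    E.IsOfGrothendieckType where
  toIsEfficient := hE.isEfficient
  deconstructible := by
    obtain ⟨D, U, hU⟩ := exists_pureSubobject_family A
    refine ⟨ObjectProperty.ofObj U, inferInstance, fun X => ?_⟩
    obtain ⟨J, _, _, _, _, _, F, h₁, h₂, h₃, h₄⟩ := exists_pureFiltration hU X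
    refine ⟨J, ‹_›, ‹_›, ‹_›, ‹_›, ‹_›, F, h₁, h₂, h₃, fun j hj => ?_⟩
    obtain ⟨d, p, w, h⟩ := h₄ j hj
    exact ⟨U d, p, w, ObjectProperty.ofObj_apply U d, hE.conflations_of_pureExact h⟩

attribute [local instance] hasFilteredColimits_of_isFinitelyAccessible

/-- Filtered colimits of complexes are termwise. The three components lift to a common stage, and
the two commutation relations hold after passing further along the diagram. -/
lemma fpConflations_le_isFinitelyPresentable :
    E.fpConflations ≤ ObjectProperty.isFinitelyPresentable.{v} (ShortComplex A) := by
  rintro S ⟨-, h₁, h₂, h₃⟩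
  refine isFinitelyPresentable_of_exists (fun J _ _ D c hc φ => ?_) (fun J _ _ D c hc j φ ψ h => ?_)
  all_goals
    have hc₁ := isColimitOfPreserves ShortComplex.π₁ hc
    have hc₂ := isColimitOfPreserves ShortComplex.π₂ hc
    have hc₃ := isColimitOfPreserves ShortComplex.π₃ hc
  · let ι (i : J) : D.obj i ⟶ c.pt := c.ι.app i
    obtain ⟨j₁, (a₁ : S.X₁ ⟶ (D.obj j₁).X₁), (ha₁ : a₁ ≫ (ι j₁).τ₁ = φ.τ₁)⟩ :=
      IsFinitelyPresentable.exists_hom_of_isColimit hc₁ φ.τ₁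
    obtain ⟨j₂, (a₂ : S.X₂ ⟶ (D.obj j₂).X₂), (ha₂ : a₂ ≫ (ι j₂).τ₂ = φ.τ₂)⟩ :=
      IsFinitelyPresentable.exists_hom_of_isColimit hc₂ φ.τ₂
    obtain ⟨j₃, (a₃ : S.X₃ ⟶ (D.obj j₃).X₃), (ha₃ : a₃ ≫ (ι j₃).τ₃ = φ.τ₃)⟩ :=
      IsFinitelyPresentable.exists_hom_of_isColimit hc₃ φ.τ₃
    obtain ⟨j, f₁, f₂, ⟨f₃⟩⟩ : ∃ j, ∃ (_ : j₁ ⟶ j) (_ : j₂ ⟶ j), Nonempty (j₃ ⟶ j) :=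
      ⟨IsFiltered.max (IsFiltered.max j₁ j₂) j₃, IsFiltered.leftToMax _ _ ≫ IsFiltered.leftToMax _ _,
        IsFiltered.rightToMax _ _ ≫ IsFiltered.leftToMax _ _, ⟨IsFiltered.rightToMax _ _⟩⟩
    have w {i k : J} (f : i ⟶ k) : D.map f ≫ ι k = ι i := c.w f
    have w₁ {i k : J} (f : i ⟶ k) : (D.map f).τ₁ ≫ (ι k).τ₁ = (ι i).τ₁ :=
      congrArg ShortComplex.Hom.τ₁ (w f)
    have w₂ {i k : J} (f : i ⟶ k) : (D.map f).τ₂ ≫ (ι k).τ₂ = (ι i).τ₂ :=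
      congrArg ShortComplex.Hom.τ₂ (w f)
    have w₃ {i k : J} (f : i ⟶ k) : (D.map f).τ₃ ≫ (ι k).τ₃ = (ι i).τ₃ :=
      congrArg ShortComplex.Hom.τ₃ (w f)
    have wf (i : J) : (D.obj i).f ≫ (ι i).τ₂ = (ι i).τ₁ ≫ c.pt.f :=
      (ι i).comm₁₂.symm
    have wg (i : J) : (D.obj i).g ≫ (ι i).τ₃ = (ι i).τ₂ ≫ c.pt.g :=
      (ι i).comm₂₃.symm
    have hf : (a₁ ≫ (D.map f₁).τ₁ ≫ (D.obj j).f) ≫ (ι j).τ₂ =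
        (S.f ≫ a₂ ≫ (D.map f₂).τ₂) ≫ (ι j).τ₂ := by
      simp only [Category.assoc, w₂, ha₂, wf, reassoc_of% w₁, reassoc_of% ha₁,
        φ.comm₁₂]
    obtain ⟨k, e, (he : _ ≫ (D.map e).τ₂ = _ ≫ (D.map e).τ₂)⟩ :=
      exists_eq_of_isFinitelyPresentable hc₂ _ _ hf
    have hg : (a₂ ≫ (D.map f₂).τ₂ ≫ (D.obj j).g ≫ (D.map e).τ₃) ≫ (ι k).τ₃ =
        (S.g ≫ a₃ ≫ (D.map f₃).τ₃ ≫ (D.map e).τ₃) ≫ (ι k).τ₃ := by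
      simp only [Category.assoc, w₃, ha₃, wg, reassoc_of% w₂, reassoc_of% ha₂,
        φ.comm₂₃]
    obtain ⟨l, d, (hd : _ ≫ (D.map d).τ₃ = _ ≫ (D.map d).τ₃)⟩ :=
      exists_eq_of_isFinitelyPresentable hc₃ _ _ hg
    simp only [Category.assoc] at he hd
    refine ⟨l,
      { τ₁ := a₁ ≫ (D.map f₁).τ₁ ≫ (D.map e).τ₁ ≫ (D.map d).τ₁
        τ₂ := a₂ ≫ (D.map f₂).τ₂ ≫ (D.map e).τ₂ ≫ (D.map d).τ₂
        τ₃ := a₃ ≫ (D.map f₃).τ₃ ≫ (D.map e).τ₃ ≫ (D.map d).τ₃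
        comm₁₂ := ?_
        comm₂₃ := ?_ }, ShortComplex.hom_ext _ _ ?_ ?_ ?_⟩
    · simp only [Category.assoc, ShortComplex.Hom.comm₁₂]
      rw [(D.map e).comm₁₂_assoc, reassoc_of% he]
    · simp only [Category.assoc, ShortComplex.Hom.comm₂₃]
      rw [(D.map e).comm₂₃_assoc, hd]
    · exact (show _ ≫ (ι l).τ₁ = _ by simp [w₁, ha₁])
    · exact (show _ ≫ (ι l).τ₂ = _ by simp [w₂, ha₂])
    · exact (show _ ≫ (ι l).τ₃ = _ by simp [w₃, ha₃])
  · have h' {i : J} (a : j ⟶ i) : (φ ≫ D.map a) ≫ c.ι.app i = (ψ ≫ D.map a) ≫ c.ι.app i := by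
      simpa using! h
    obtain ⟨i₁, a₁, (h₁ : φ.τ₁ ≫ (D.map a₁).τ₁ = ψ.τ₁ ≫ (D.map a₁).τ₁)⟩ :=
      exists_eq_of_isFinitelyPresentable hc₁ φ.τ₁ ψ.τ₁ (congrArg ShortComplex.Hom.τ₁ h)
    obtain ⟨i₂, a₂, (h₂ : (φ ≫ D.map a₁).τ₂ ≫ (D.map a₂).τ₂ = (ψ ≫ D.map a₁).τ₂ ≫ (D.map a₂).τ₂)⟩ :=
      exists_eq_of_isFinitelyPresentable hc₂ (φ ≫ D.map a₁).τ₂ (ψ ≫ D.map a₁).τ₂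
        (congrArg ShortComplex.Hom.τ₂ (h' a₁))
    obtain ⟨i₃, a₃, (h₃ : (φ ≫ D.map (a₁ ≫ a₂)).τ₃ ≫ (D.map a₃).τ₃ =
        (ψ ≫ D.map (a₁ ≫ a₂)).τ₃ ≫ (D.map a₃).τ₃)⟩ :=
      exists_eq_of_isFinitelyPresentable hc₃ (φ ≫ D.map (a₁ ≫ a₂)).τ₃ (ψ ≫ D.map (a₁ ≫ a₂)).τ₃
        (congrArg ShortComplex.Hom.τ₃ (h' (a₁ ≫ a₂)))
    refine ⟨i₃, a₁ ≫ a₂ ≫ a₃, ShortComplex.hom_ext _ _ ?_ ?_ ?_⟩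
    · simp [reassoc_of% h₁]
    · simp only [ShortComplex.comp_τ₂, Category.assoc] at h₂
      simp [reassoc_of% h₂]
    · simp only [ShortComplex.comp_τ₃, Functor.map_comp, Category.assoc] at h₃
      simp [h₃]

lemma IsLocallyCoherent.hasExactDirectedColimits (hE : E.IsLocallyCoherent) :
    E.HasExactDirectedColimits where
  hasColimits J _ _ _ := inferInstance
  closed J _ _ _ := by
    -- Replacing filtered indexing categories by directed posets identifies conflations with an
    -- ind-closure, which is idempotent on finitely presentable objects.
    have h : E.conflations = ObjectProperty.ind.{v} E.fpConflations := by
      ext S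
      rw [hE]
      constructor
      · rintro ⟨J, _, _, _, ⟨p⟩⟩
        exact ⟨J, inferInstance, inferInstance, p.toColimitPresentation, p.prop_diag_obj⟩
      · rintro ⟨J, _, _, p, hp⟩
        obtain ⟨α, _, _, _, F, _⟩ := IsFiltered.exists_directed J
        exact ⟨α, inferInstance, inferInstance, inferInstance,
          E.fpConflations.colimitsOfShape_le_of_final F _ ⟨{ p with prop_diag_obj := hp }⟩⟩
    rw [h]
    refine ⟨?_⟩
    rintro S ⟨p⟩
    rw [← ObjectProperty.ind_ind fpConflations_le_isFinitelyPresentable]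
    exact ⟨J, inferInstance, inferInstance, p.toColimitPresentation, p.prop_diag_obj⟩

end ExactStructure

/-! ### Attaching a set of inflations simultaneously. -/

section Attach

variable {A : Type u} [Category.{v} A] {Θ : Type v} {K L : Θ → A} (f : ∀ i, K i ⟶ L i)
  {X : A} (a : ∀ i, K i ⟶ X)

/-- The object obtained from `X` by attaching, along `a i`, the morphisms `f i` for finitely
many indices `i`. -/
structure FiniteAttachment (S : Finset Θ) where
  pt : A
  inl : X ⟶ pt
  inr (i : Θ) : i ∈ S → (L i ⟶ pt)
  condition (i : Θ) (hi : i ∈ S) : f i ≫ inr i hi = a i ≫ inl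
  exists_desc {T : A} (k : X ⟶ T) (z : ∀ i, i ∈ S → (L i ⟶ T))
    (h : ∀ i hi, f i ≫ z i hi = a i ≫ k) :
    ∃ l : pt ⟶ T, inl ≫ l = k ∧ ∀ i hi, inr i hi ≫ l = z i hi
  hom_ext {T : A} {l m : pt ⟶ T} (h : inl ≫ l = inl ≫ m)
    (h' : ∀ i hi, inr i hi ≫ l = inr i hi ≫ m) : l = m

variable {f a}

/-- A pushout adds one index to a finite attachment. -/
noncomputable def FiniteAttachment.insert [DecidableEq Θ] {S : Finset Θ}
    (P : FiniteAttachment f a S) {i : Θ} {Q : A} {g : L i ⟶ Q} {j : P.pt ⟶ Q}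
    (h : IsPushout (f i) (a i ≫ P.inl) g j)
    (hi : i ∉ S) : FiniteAttachment f a (insert i S) where
  pt := Q
  inl := P.inl ≫ j
  inr k hk := if e : k = i then eqToHom (by rw [e]) ≫ g else
    P.inr k (Finset.mem_of_mem_insert_of_ne hk e) ≫ j
  condition k hk := by
    by_cases e : k = i
    · subst e
      simp [h.w]
    · simp [dif_neg e, reassoc_of% P.condition]
  exists_desc {T} k z hz := by
    obtain ⟨l, hl, hl'⟩ := P.exists_desc k (fun i hi => z i (Finset.mem_insert_of_mem hi))
      (fun i hi => hz i _)
    refine ⟨h.desc (z i (Finset.mem_insert_self i S)) l (by rw [hz, Category.assoc, hl]), by simp [hl], fun k hk => ?_⟩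
    by_cases e : k = i
    · subst e
      simp
    · simp [dif_neg e, hl']
  hom_ext {T l m} h₁ h₂ := by
    refine h.hom_ext (by simpa using h₂ i (Finset.mem_insert_self i S)) (P.hom_ext ?_ ?_)
    · simpa using h₁
    · intro k hk
      by_cases e : k = i
      · exact (hi (e ▸ hk)).elim
      · simpa [dif_neg e] using h₂ k (Finset.mem_insert_of_mem hk)

variable (f a) in
lemma FiniteAttachment.exists_inflation [Preadditive A] {E : ExactStructure A}
    (hf : ∀ i, E.inflations (f i)) (S : Finset Θ) :
    ∃ P : FiniteAttachment f a S, E.inflations P.inl := by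
  classical
  induction S using Finset.induction_on with
  | empty =>
    exact ⟨{ pt := X
             inl := 𝟙 X
             inr := fun i hi => (Finset.notMem_empty i hi).elim
             condition := fun i hi => (Finset.notMem_empty i hi).elim
             exists_desc := fun k _ _ => ⟨k, by simp, fun i hi => (Finset.notMem_empty i hi).elim⟩
             hom_ext := fun h _ => by simpa using h }, E.inflations.id_mem X⟩
  | insert i S hi ih =>
    obtain ⟨P, hP⟩ := ih
    obtain ⟨Q, g, j, h, hj⟩ := E.inflation_pushout (f i) (a i ≫ P.inl) (hf i)
    exact ⟨P.insert h hi, E.inflations.comp_mem _ _ hP hj⟩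

variable (f a) in
-- Finitely many inflations are attached by iterated pushouts. The full attachment is the directed
-- colimit over finite sets of indices, and X → P is a colimit of inflations out of the constant
-- diagram X.
lemma ExactStructure.HasExactDirectedColimits.exists_attachment [Preadditive A]
    [IsFinitelyAccessibleCategory.{v} A] {E : ExactStructure A}
    (hE : E.HasExactDirectedColimits) (hf : ∀ i, E.inflations (f i)) :
    ∃ (P : A) (h : X ⟶ P), E.inflations h ∧ ∀ i, ∃ b : L i ⟶ P, f i ≫ b = a i ≫ h := by
  classical
  choose P hP using FiniteAttachment.exists_inflation f a hf
  choose t ht ht' using fun {S T : Finset Θ} (h : S ≤ T) =>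
    (P S).exists_desc (P T).inl (fun i hi => (P T).inr i (h hi)) (fun i hi => (P T).condition i _)
  let F : Finset Θ ⥤ A :=
    { obj := fun S => (P S).pt
      map := fun g => t (leOfHom g)
      map_id := fun S => (P S).hom_ext (by simp [ht]) (by simp [ht'])
      map_comp := fun {S T U} g h => (P S).hom_ext (by simp [ht, reassoc_of% ht])
        (by simp [ht', reassoc_of% ht']) }
  have := hE.hasColimits (Finset Θ)
  have hstable := hE.isStableUnderFilteredColimits
  let α : (Functor.const (Finset Θ)).obj X ⟶ F :=
    { app := fun S => (P S).inl
      naturality := fun S T g => (Category.id_comp _).trans (ht (leOfHom g)).symm }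
  have hα (S : Finset Θ) : (P S).inl ≫ colimit.ι F S = (P ∅).inl ≫ colimit.ι F ∅ := by
    rw [← ht (Finset.empty_subset S), Category.assoc]
    exact congrArg _ (colimit.w F (homOfLE (Finset.empty_subset S)))
  have := IsFiltered.isConnected (Finset Θ)
  refine ⟨colimit F, (P ∅).inl ≫ colimit.ι F ∅,
    MorphismProperty.colimitsOfShape_le (W := E.inflations) (J := Finset Θ) _
      (MorphismProperty.colimitsOfShape.mk' _ _ _ _ (isColimitConstCocone _ X)
        (colimit.isColimit F) α hP _ fun S => ?_), fun i => ⟨(P {i}).inr i (by simp) ≫ colimit.ι F _, ?_⟩⟩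
  · exact (Category.id_comp _).trans (hα S).symm
  · rw [← Category.assoc, (P {i}).condition, Category.assoc, hα]

end Attach

/-! ### The small object argument. -/

section

variable {A : Type u} [Category.{v} A] [IsFinitelyAccessibleCategory.{v} A]

lemma exists_isCardinalPresentable {Θ : Type v} (K : Θ → A) :
    ∃ (κ : Cardinal.{v}) (_ : Fact κ.IsRegular), ∀ i, IsCardinalPresentable (K i) κ := by
  have : IsAccessibleCategory.{v} A := ⟨_, Cardinal.fact_isRegular_aleph0, inferInstance⟩
  choose κ hκ h using fun i => (inferInstance : IsPresentable.{v} (K i)).exists_cardinal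
  obtain ⟨κ', h', hκ'⟩ := HasCardinalLT.exists_regular_cardinal_forall (fun i => (κ i).ord.ToType)
  have : Fact κ'.IsRegular := ⟨h'⟩
  refine ⟨κ', ⟨h'⟩, fun i => ?_⟩
  have : IsCardinalPresentable (K i) (κ i) := h i
  exact isCardinalPresentable_of_le (K i) (κ := κ i)
    (le_of_lt (by simpa [hasCardinalLT_iff_cardinal_mk_lt] using hκ' i))

attribute [local instance] hasFilteredColimits_of_isFinitelyAccessible

lemma hasIterationOfShape_of_isFinitelyAccessible (J : Type v) [LinearOrder J] [Nonempty J] :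
    HasIterationOfShape J A where
  hasColimitsOfShape_of_isSuccLimit j hj := by
    have : Nonempty (Set.Iio j) := let ⟨i, hi⟩ := not_isMin_iff.1 hj.not_isMin; ⟨i, hi⟩
    infer_instance

variable [Preadditive A] {E : ExactStructure A}

/-- The small object argument for a set of inflations. -/
lemma ExactStructure.HasExactDirectedColimits.exists_inflation_extending
    (hE : E.HasExactDirectedColimits) {Θ : Type v} {K L : Θ → A} (f : ∀ i, K i ⟶ L i)
    (hf : ∀ i, E.inflations (f i)) (X : A) :
    ∃ (I : A) (h : X ⟶ I), E.inflations h ∧ ∀ i (a : K i ⟶ I), ∃ b, f i ≫ b = a := by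
  choose P h hh b hb using fun X : A => hE.exists_attachment
    (Θ := Σ i, (K i ⟶ X)) (fun i => f i.1) (fun i => i.2) (fun i => hf i.1)
  let Φ : SmallObject.SuccStruct A := { X₀ := X, succ := P, toSucc := h }
  -- With κ bounding the presentability of all K i, a map from K i to the κ-long iteration factors
  -- through some stage j; its extension appears at stage j + 1.
  obtain ⟨κ, hκ, _⟩ := exists_isCardinalPresentable K
  let J := κ.ord.ToType
  have : Nonempty J := by simpa [J] using Cardinal.IsRegular.ne_zero Fact.out
  let : OrderBot J := WellFoundedLT.toOrderBot J
  let : SuccOrder J := SuccOrder.ofLinearWellFoundedLT J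
  have : NoMaxOrder J := Cardinal.noMaxOrder (Cardinal.IsRegular.aleph0_le Fact.out)
  have := hasIterationOfShape_of_isFinitelyAccessible (A := A) J
  have := hE.isStableUnderFilteredColimits
  have hΦ : Φ.prop ≤ E.inflations := by
    rintro _ _ _ ⟨⟩
    exact hh _
  refine ⟨Φ.iteration J, Φ.ιIteration J, E.inflations.transfiniteCompositionsOfShape_le J _
    ⟨(Φ.transfiniteCompositionOfShapeιIteration J).ofLE hΦ⟩, fun i a => ?_⟩
  obtain ⟨j, a', rfl⟩ := IsCardinalPresentable.exists_hom_of_isColimit κ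
    (Φ.isColimitIterationCocone J) a
  let Y := (Φ.iterationFunctor J).obj j
  have h₁ : (Φ.iterationFunctor J).map (homOfLE (Order.le_succ j)) =
      h Y ≫ (Φ.iterationFunctorObjSuccIso j (not_isMax j)).inv :=
    Φ.iterationFunctor_map_succ j (not_isMax j)
  have h₂ := (Φ.iterationCocone J).w (homOfLE (Order.le_succ j))
  let e : P Y ⟶ Φ.iteration J := (Φ.iterationFunctorObjSuccIso j (not_isMax j)).inv ≫
    (Φ.iterationCocone J).ι.app (Order.succ j)
  have h₃ : h Y ≫ e = (Φ.iterationCocone J).ι.app j :=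
    (Category.assoc _ _ _).symm.trans ((congrArg (· ≫ _) h₁.symm).trans h₂)
  refine ⟨b Y ⟨i, a'⟩ ≫ e, (Category.assoc _ _ _).symm.trans ?_⟩
  exact (congrArg (· ≫ e) (hb Y ⟨i, a'⟩)).trans ((Category.assoc _ _ _).trans
    (congrArg (a' ≫ ·) h₃))

end

/-! ### Enough injectives in the locally coherent case. -/

section

variable {A : Type u} [Category.{v} A] [Preadditive A]
  [IsFinitelyAccessibleCategory.{v} A] {E : ExactStructure A}

attribute [local instance] hasFilteredColimits_of_isFinitelyAccessible

/-- The element z factors through the third term of a finitely presentable conflation mapping to T.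
Extending the first component to b and subtracting b ≫ T.f from the second gives a map vanishing on
the first term, hence a lift from the third. -/
lemma ExactStructure.IsLocallyCoherent.exists_lift_of_extends (hE : E.IsLocallyCoherent) {T : ShortComplex A}
    (hT : E.conflations T)
    (h : ∀ S, E.fpConflations S → ∀ a : S.X₁ ⟶ T.X₁, ∃ b, S.f ≫ b = a)
    (s : FP A) (z : s.obj ⟶ T.X₃) : ∃ y, y ≫ T.g = z := by
  obtain ⟨J, _, _, _, ⟨c⟩⟩ := (hE T).1 hT
  obtain ⟨j, (z' : s.obj ⟶ (c.diag.obj j).X₃), (hz : z' ≫ (c.ι.app j).τ₃ = z)⟩ :=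
    IsFinitelyPresentable.exists_hom_of_isColimit (isColimitOfPreserves ShortComplex.π₃ c.isColimit)
      z
  let ι : c.diag.obj j ⟶ T := c.ι.app j
  obtain ⟨b, hb⟩ := h _ (c.prop_diag_obj j) ι.τ₁
  have hj : E.conflations (c.diag.obj j) := (c.prop_diag_obj j).1
  have := ExactStructure.conflations.epi_g hj
  obtain ⟨l, hl⟩ := ExactStructure.conflations.exists_desc hj (ι.τ₂ - b ≫ T.f) (by
    rw [Preadditive.comp_sub, reassoc_of% hb, ι.comm₁₂, sub_self])
  have hl' : l ≫ T.g = ι.τ₃ := by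
    rw [← cancel_epi (c.diag.obj j).g, reassoc_of% hl, Preadditive.sub_comp, Category.assoc,
      T.zero, comp_zero, sub_zero, ι.comm₂₃]
  exact ⟨z' ≫ l, by rw [Category.assoc, hl']; exact hz⟩

variable [HasFiniteBiproducts A]

attribute [local instance]
  hasCoproducts_of_isFinitelyAccessible hasBinaryBiproducts_of_finite_biproducts

/-- Every object is a pure quotient of a pure projective object. -/
lemma exists_pureProjective (X : A) :
    ∃ (K P : A) (k : K ⟶ P) (p : P ⟶ X) (w : k ≫ p = 0), PureExact (ShortComplex.mk k p w) ∧
      ∀ {Y Z : A} (q : Y ⟶ Z) (_ : ∀ (s : FP A) (z : s.obj ⟶ Z), ∃ y, y ≫ q = z) (g : P ⟶ Z),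
        ∃ t, t ≫ q = g := by
  let F (i : Σ s : FP A, (s.obj ⟶ X)) : A := i.1.obj
  let p : ∐ F ⟶ X := Sigma.desc fun i => i.2
  obtain ⟨K, k, w, h⟩ := exists_pureExact_of_surjective p
    (fun s z => ⟨Sigma.ι F ⟨s, z⟩, by simp [p]⟩)
  refine ⟨K, ∐ F, k, p, w, h, fun {Y Z} q hq g => ?_⟩
  choose t ht using fun i => hq _ (Sigma.ι F i ≫ g)
  exact ⟨Sigma.desc t, Sigma.hom_ext _ _ fun i => by simp [ht]⟩

namespace ExactStructure

/-- Extending all maps K → T.X₁ to P amounts to vanishing of the relevant Ext¹. The middle term of S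
is a pure quotient of S.X₁ ⊞ P, so a lift is a pair (u, t₂) compatible on K; `hK` corrects an
arbitrary lift on P to a compatible one. -/
lemma HasExactDirectedColimits.hasLiftingProperty (hE : E.HasExactDirectedColimits)
    {S T : ShortComplex A} (hS : PureExact S) (hT : E.conflations T)
    (hTg : ∀ (s : FP A) (z : s.obj ⟶ T.X₃), ∃ y, y ≫ T.g = z)
    {K P : A} {k : K ⟶ P} {p : P ⟶ S.X₃} {w : k ≫ p = 0} (h : PureExact (ShortComplex.mk k p w))
    (hP : ∀ {Y Z : A} (q : Y ⟶ Z) (_ : ∀ (s : FP A) (z : s.obj ⟶ Z), ∃ y, y ≫ q = z)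
      (g : P ⟶ Z), ∃ t, t ≫ q = g)
    (hK : ∀ e : K ⟶ T.X₁, ∃ e', k ≫ e' = e) : HasLiftingProperty S.f T.g := by
  refine ⟨fun {u v} sq => ?_⟩
  have hS' := hE.conflations_of_pureExact hS
  have := conflations.mono_f hS'
  obtain ⟨t, ht⟩ := hP S.g hS.epi p
  obtain ⟨m, hm⟩ := conflations.exists_lift hS' (k ≫ t) (by rw [Category.assoc, ht, w])
  obtain ⟨t₁, ht₁⟩ := hP T.g hTg (t ≫ v)
  obtain ⟨e, he⟩ := conflations.exists_lift hT (k ≫ t₁ - m ≫ u) (by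
    rw [Preadditive.sub_comp, Category.assoc, ht₁, Category.assoc, sq.w, ← reassoc_of% hm,
      sub_self])
  obtain ⟨e', rfl⟩ := hK e
  let t₂ : P ⟶ T.X₂ := t₁ - e' ≫ T.f
  have hkt : k ≫ t₂ = m ≫ u := by
    rw [Preadditive.comp_sub, ← Category.assoc, he, sub_sub_cancel]
  have htg : t₂ ≫ T.g = t ≫ v := by
    rw [Preadditive.sub_comp, Category.assoc, T.zero, comp_zero, sub_zero, ht₁]
  -- Elements of N have the form (-(y ≫ m), y ≫ k) with y an element of K, so `hkt` says exactly
  -- that (u, t₂) vanishes on N.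
  obtain ⟨N, n, hn, hN⟩ := exists_pureExact_of_surjective (biprod.desc S.f t) (fun s z => by
    obtain ⟨y, hy⟩ := h.epi s (z ≫ S.g)
    dsimp at y hy
    obtain ⟨x, hx⟩ := hS.exact s (z - y ≫ t) (by
      rw [Preadditive.sub_comp, Category.assoc, ht, hy, sub_self])
    exact ⟨biprod.lift x y, by rw [biprod.lift_desc, hx, sub_add_cancel]⟩)
  have hN' := hE.conflations_of_pureExact hN
  have := conflations.epi_g hN'
  dsimp at this
  obtain ⟨l, hl⟩ := conflations.exists_desc hN' (biprod.desc u t₂) (FP.hom_ext fun s z => by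
    have hz : (z ≫ n ≫ biprod.fst) ≫ S.f + (z ≫ n ≫ biprod.snd) ≫ t = 0 := by
      simpa [biprod.desc_eq] using z ≫= hn
    have hzp : (z ≫ n ≫ biprod.snd) ≫ p = 0 := by
      simpa [ht] using hz =≫ S.g
    obtain ⟨y, hy⟩ := h.exact s (z ≫ n ≫ biprod.snd) hzp
    dsimp at y hy
    have hy' : z ≫ n ≫ biprod.fst = -(y ≫ m) := by
      rw [← cancel_mono S.f, Preadditive.neg_comp, Category.assoc y, hm, ← Category.assoc y, hy,
        eq_neg_iff_add_eq_zero, hz]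
    calc z ≫ n ≫ biprod.desc u t₂
        = (z ≫ n ≫ biprod.fst) ≫ u + (z ≫ n ≫ biprod.snd) ≫ t₂ := by simp [biprod.desc_eq]
      _ = z ≫ 0 := by rw [hy', ← hy, Category.assoc, hkt]; simp)
  dsimp at hl
  refine ⟨⟨⟨l, ?_, ?_⟩⟩⟩
  · simpa using biprod.inl ≫= hl
  · rw [← cancel_epi (biprod.desc S.f t), reassoc_of% hl]
    ext
    · simp [sq.w]
    · simp [htg]

lemma IsLocallyCoherent.enoughInjectives (hE : E.IsLocallyCoherent) : E.EnoughInjectives := by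
  have hE' := hE.hasExactDirectedColimits
  obtain ⟨D, U, hU⟩ := exists_pureSubobject_family A
  choose K P k p w hp hP using fun d => exists_pureProjective (U d)
  intro X
  let Θ : Type v := D ⊕ { q : Σ s t : FP A, (s.obj ⟶ t.obj) // E.inflations q.2.2 }
  obtain ⟨I, h, hh, hI⟩ := hE'.exists_inflation_extending (Θ := Θ)
    (K := Sum.elim K fun q => q.1.1.obj) (L := Sum.elim P fun q => q.1.2.1.obj)
    (fun i => match i with
      | .inl d => k d
      | .inr q => q.1.2.2)
    (fun i => match i with
      | .inl d => ⟨_, p d, w d, hE'.conflations_of_pureExact (hp d)⟩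
      | .inr q => q.2) X
  have hfp (S : ShortComplex A) (hS : E.fpConflations S) (a : S.X₁ ⟶ I) : ∃ b, S.f ≫ b = a := by
    obtain ⟨hS, h₁, h₂, -⟩ := hS
    obtain ⟨s, ⟨e⟩⟩ := FP.exists_iso S.X₁
    obtain ⟨t, ⟨e'⟩⟩ := FP.exists_iso S.X₂
    have hi : E.inflations (e.hom ≫ S.f ≫ e'.inv) :=
      MorphismProperty.RespectsIso.precomp _ _ _
        (MorphismProperty.RespectsIso.postcomp _ _ _ ⟨S.X₃, S.g, S.zero, hS⟩)
    obtain ⟨(b : t.obj ⟶ I), (hb : (e.hom ≫ S.f ≫ e'.inv) ≫ b = e.hom ≫ a)⟩ :=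
      hI (.inr ⟨⟨s, t, e.hom ≫ S.f ≫ e'.inv⟩, hi⟩) (e.hom ≫ a)
    exact ⟨e'.inv ≫ b, by simpa using hb⟩
  refine ⟨I, h, ?_, hh⟩
  intro V Y i f hi
  -- After pushing out along f, it suffices to split a conflation starting at I.
  obtain ⟨Y', f', i', hY', Z, g, w', hZ⟩ := E.inflation_pushout i f hi
  have hg : ∀ (s : FP A) (z : s.obj ⟶ Z), ∃ y, y ≫ g = z :=
    hE.exists_lift_of_extends hZ hfp
  obtain ⟨J, _, _, _, _, _, F, hF, hF₀, ⟨e⟩, hF'⟩ := exists_pureFiltration hU Z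
  have hlift (j : J) (hj : ¬ IsMax j) :
      HasLiftingProperty (F.map (homOfLE (Order.le_succ j))) g := by
    obtain ⟨d, q, wq, hq⟩ := hF' j hj
    exact hE'.hasLiftingProperty hq hZ hg (hp d) (hP d) fun a => hI (.inl d) a
  have := HasLiftingProperty.transfiniteComposition.hasLiftingProperty_ι_app_bot
    (hc := colimitOfDiagramTerminal isTerminalTop F) hlift
  -- Lifting along 0 → Z, composed from the filtration steps, gives a section of g and thereby a
  -- retraction of i'.
  have sq : CommSq (0 : F.obj ⊥ ⟶ Y') ((coconeOfDiagramTerminal isTerminalTop F).ι.app ⊥) g e.hom :=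
    ⟨hF₀.eq_of_src _ _⟩
  have hl : sq.lift ≫ g = e.hom := sq.fac_right
  obtain ⟨r, hr⟩ := conflations.exists_lift hZ (𝟙 Y' - g ≫ e.inv ≫ sq.lift) (by
    dsimp
    rw [Preadditive.sub_comp, Category.assoc, Category.assoc, hl, e.inv_hom_id]
    simp)
  dsimp at hr
  have := conflations.mono_f hZ
  dsimp at this
  have hr' : i' ≫ r = 𝟙 I := by
    rw [← cancel_mono i', Category.assoc, hr, Preadditive.comp_sub, reassoc_of% w']
    simp
  exact ⟨f' ≫ r, by rw [hY'.w_assoc, hr', Category.comp_id]⟩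

end ExactStructure

end

theorem theorem5p5 {A : Type u} [Category.{v} A] [Preadditive A] [HasFiniteBiproducts A]
    [IsFinitelyAccessibleCategory.{v} A] (E : ExactStructure A) :
    (E.HasExactDirectedColimits → E.IsOfGrothendieckType) ∧
    (E.IsLocallyCoherent → E.IsOfGrothendieckType ∧ E.EnoughInjectives) := by
  exact ⟨fun h => h.isOfGrothendieckType, fun h =>
    ⟨h.hasExactDirectedColimits.isOfGrothendieckType, h.enoughInjectives⟩⟩
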